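/- Equip $\mathrm{SU}(3)$ with a bi-invariant Riemannian metric, i.e. with the left translates of an $\mathrm{Ad}$-invariant inner product $B$ on $\mathfrak{su}(3)$ (for instance $B(X,Y)=-\tfrac12\operatorname{Tr}(XY)$), and embed $\mathrm{SO}(3)$ in $\mathrm{SU}(3)$ as the subgroup of real matrices. Then there is exactly one smooth Riemannian metric $g$ on the Wu manifold $\mathrm{SU}(3)/\mathrm{SO}(3)$ for which the projection $\pi:\mathrm{SU}(3)\to \mathrm{SU}(3)/\mathrm{SO}(3)$, $u\mapsto u\,\mathrm{SO}(3)$, is a Riemannian submersion (the symmetric space metric), and $g$ has positive biorthogonal curvature: for every point $p$ and every 2-plane $\sigma\subset T_p(\mathrm{SU}(3)/\mathrm{SO}(3))$, $$\sec_g^{\perp}(\sigma):=\min_{\sigma'\subset\sigma^{\perp}}\tfrac12\bigl(\sec_g(\sigma)+\sec_g(\sigma')\bigr)>0,$$ where $\sec_g$ is the sectional curvature, $\sigma^\perp$ is the $g$-orthogonal complement of $\sigma$ in the tangent space, and $\sigma'$ ranges over the 2-planes contained in $\sigma^\perp$. -/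

import Mathlib

open scoped Matrix Manifold ContDiff Topology

namespace Wu

noncomputable section

/-- Complex `3 × 3` matrices. -/
abbrev Mat : Type := Matrix (Fin 3) (Fin 3) ℂ

/-- The special unitary group `SU(3)`, with the subspace topology of the matrices. -/
abbrev SU3 : Type := Matrix.specialUnitaryGroup (Fin 3) ℂ

lemma SU3.mul_conjTranspose (u : SU3) : (u : Mat) * (u : Mat)ᴴ = 1 :=
  Matrix.mem_unitaryGroup_iff.1 u.2.1

lemma SU3.conjTranspose_mul (u : SU3) : (u : Mat)ᴴ * (u : Mat) = 1 :=
  Matrix.mem_unitaryGroup_iff'.1 u.2.1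

lemma SU3.det (u : SU3) : (u : Mat).det = 1 := u.2.2

lemma SU3.coe_inv (u : SU3) : ((u⁻¹ : SU3) : Mat) = (u : Mat)ᴴ := rfl

lemma mem_SU3 {A : Mat} (h : A * Aᴴ = 1) (hd : A.det = 1) :
    A ∈ Matrix.specialUnitaryGroup (Fin 3) ℂ :=
  Matrix.mem_specialUnitaryGroup_iff.2 ⟨Matrix.mem_unitaryGroup_iff.2 h, hd⟩

/-- `SO(3)`, embedded in `SU(3)` as the real matrices. -/
def SO3 : Subgroup SU3 where
  carrier := {u | ∃ r ∈ Matrix.specialOrthogonalGroup (Fin 3) ℝ, (u : Mat) = r.map (algebraMap ℝ ℂ)}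
  mul_mem' := by
    rintro u v ⟨r, hr, hu⟩ ⟨s, hs, hv⟩
    refine ⟨r * s, mul_mem hr hs, ?_⟩
    rw [Matrix.map_mul, ← hu, ← hv]; rfl
  one_mem' := ⟨1, one_mem _, by simp⟩
  inv_mem' := by
    rintro u ⟨r, hr, hu⟩
    refine ⟨rᵀ, ?_, ?_⟩
    · rw [Matrix.mem_specialOrthogonalGroup_iff] at hr ⊢
      refine ⟨?_, by rw [Matrix.det_transpose]; exact hr.2⟩
      have h := (Matrix.mem_orthogonalGroup_iff' (Fin 3) ℝ).1 hr.1
      rw [Matrix.mem_orthogonalGroup_iff, Matrix.transpose_transpose]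
      exact h
    · rw [SU3.coe_inv, hu]
      ext i j
      simp [Matrix.conjTranspose_apply]

/-- The Wu manifold `SU(3)/SO(3)`, with the quotient topology. -/
abbrev WuManifold : Type := SU3 ⧸ SO3

/-- The canonical projection `π : SU(3) → SU(3)/SO(3)`. -/
def proj (u : SU3) : WuManifold := QuotientGroup.mk u

/-- The real vector space underlying the Lie algebra `𝔰𝔲(3)` (skew-Hermitian, trace-free). -/
def su3 : Submodule ℝ Mat where
  carrier := {X | Xᴴ = -X ∧ X.trace = 0}
  add_mem' := by
    rintro X Y ⟨h1, h2⟩ ⟨h3, h4⟩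
    exact ⟨by rw [Matrix.conjTranspose_add, h1, h3, neg_add], by rw [Matrix.trace_add, h2, h4, add_zero]⟩
  zero_mem' := by simp
  smul_mem' := by
    rintro c X ⟨h1, h2⟩
    exact ⟨by rw [Matrix.conjTranspose_smul, h1]; simp, by rw [Matrix.trace_smul, h2, smul_zero]⟩

/-- The adjoint action `Ad_u X = u X u⁻¹` of `SU(3)` on `𝔰𝔲(3)`. -/
def Ad (u : SU3) (X : su3) : su3 :=
  ⟨(u : Mat) * (X : Mat) * (u : Mat)ᴴ, by
    obtain ⟨X, h1, h2⟩ := X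
    refine ⟨?_, ?_⟩
    · simp [Matrix.conjTranspose_mul, h1, Matrix.mul_assoc]
    · rw [Matrix.mul_assoc, Matrix.trace_mul_comm, Matrix.mul_assoc, SU3.conjTranspose_mul,
        Matrix.mul_one, h2]⟩

lemma det_exp_of_skew {A : Mat} (hA : Aᴴ = -A) :
    (NormedSpace.exp A).det = Complex.exp A.trace := by
  set H : Mat := (-Complex.I) • A with hH
  have hHerm : H.IsHermitian := by
    unfold Matrix.IsHermitian
    rw [hH, Matrix.conjTranspose_smul, hA]
    simp
  have hAH : A = Complex.I • H := by
    rw [hH, smul_smul]; simp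
  set U : Mat := (hHerm.eigenvectorUnitary : Mat) with hU
  have hUU : Uᴴ * U = 1 := Matrix.mem_unitaryGroup_iff'.1 hHerm.eigenvectorUnitary.2
  have hUU' : U * Uᴴ = 1 := Matrix.mem_unitaryGroup_iff.1 hHerm.eigenvectorUnitary.2
  have hinv : U⁻¹ = Uᴴ := Matrix.inv_eq_left_inv hUU
  have hunit : IsUnit U := ⟨⟨U, Uᴴ, hUU', hUU⟩, rfl⟩
  set d : Fin 3 → ℂ := fun i => Complex.I * (hHerm.eigenvalues i : ℂ) with hd
  have hspec : A = U * Matrix.diagonal d * U⁻¹ := by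
    rw [hinv]
    have h := hHerm.spectral_theorem
    rw [hAH]
    conv_lhs => rw [h]
    have : Matrix.diagonal d
        = Complex.I • Matrix.diagonal (RCLike.ofReal ∘ hHerm.eigenvalues : Fin 3 → ℂ) := by
      rw [← Matrix.diagonal_smul]; rfl
    rw [this, Matrix.mul_smul, Matrix.smul_mul]
    rfl
  have htr : A.trace = ∑ i, d i := by
    conv_lhs => rw [hspec]
    rw [Matrix.trace_mul_comm, ← Matrix.mul_assoc, hinv, hUU, Matrix.one_mul, Matrix.trace_diagonal]
  rw [htr, Complex.exp_sum]
  conv_lhs => rw [hspec]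
  rw [Matrix.exp_conj _ _ hunit, Matrix.exp_diagonal, Matrix.det_conj hunit, Matrix.det_diagonal]
  refine Finset.prod_congr rfl fun i _ => ?_
  rw [Pi.coe_exp, Complex.exp_eq_exp_ℂ]

lemma exp_mem_SU3 (X : su3) :
    NormedSpace.exp (X : Mat) ∈ Matrix.specialUnitaryGroup (Fin 3) ℂ := by
  have h1 : (X : Mat)ᴴ = -X := X.2.1
  have h2 : (X : Mat).trace = 0 := X.2.2
  refine mem_SU3 ?_ ?_
  · rw [← Matrix.exp_conjTranspose, h1, Matrix.exp_neg]
    exact Matrix.mul_nonsing_inv _ ((Matrix.isUnit_iff_isUnit_det _).1 (Matrix.isUnit_exp (X : Mat)))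
  · rw [det_exp_of_skew h1, h2, Complex.exp_zero]

/-- The exponential map `𝔰𝔲(3) → SU(3)`. -/
def expSU (X : su3) : SU3 := ⟨NormedSpace.exp (X : Mat), exp_mem_SU3 X⟩

/-- The Euclidean space `ℝⁿ`. -/
abbrev E (n : ℕ) : Type := EuclideanSpace ℝ (Fin n)

/-- The parametrization of the space of matrices `i S`, with `S` real symmetric and trace-free. -/
def sym : E 5 →ₗ[ℝ] su3 where
  toFun x := ⟨Complex.I • (!![x 0, x 2, x 3; x 2, x 1, x 4; x 3, x 4, -x 0 - x 1] :
      Matrix (Fin 3) (Fin 3) ℝ).map (algebraMap ℝ ℂ), by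
    refine ⟨?_, ?_⟩
    · ext i j
      fin_cases i <;> fin_cases j <;> simp [Matrix.conjTranspose_apply]
    · simp [Matrix.trace_fin_three]⟩
  map_add' x y := by
    ext i j
    fin_cases i <;> fin_cases j <;> simp <;> ring
  map_smul' c x := by
    ext i j
    fin_cases i <;> fin_cases j <;> simp <;> ring

/-- The five coordinates of `i S`; a left inverse of `sym`. -/
def coord (A : Mat) : E 5 :=
  WithLp.toLp 2 ![(A 0 0).im, (A 1 1).im, (A 0 1).im, (A 0 2).im, (A 1 2).im]

lemma coord_sym (x : E 5) : coord (sym x) = x := by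
  ext i
  fin_cases i <;> simp [coord, sym]

lemma sym_transpose (x : E 5) : (sym x : Mat)ᵀ = sym x := by
  ext i j
  fin_cases i <;> fin_cases j <;> simp [sym]

lemma sym_coord {A : Mat} (h1 : Aᵀ = A) (h2 : Aᴴ = -A) (h3 : A.trace = 0) :
    (sym (coord A) : Mat) = A := by
  have key : ∀ i j, (A i j).re = 0 := by
    intro i j
    have a := congrFun (congrFun h2 i) j
    have b := congrFun (congrFun h1 i) j
    rw [Matrix.conjTranspose_apply] at a
    rw [Matrix.transpose_apply] at b
    rw [b] at a
    have := congrArg Complex.re a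
    simp at this
    linarith
  have hs : ∀ i j, A i j = A j i := fun i j => by
    conv_lhs => rw [← h1]
    rfl
  have htr : (A 2 2).im = -(A 0 0).im - (A 1 1).im := by
    have := congrArg Complex.im h3
    rw [Matrix.trace_fin_three] at this
    simp at this
    linarith
  ext i j
  apply Complex.ext
  · rw [key]
    fin_cases i <;> fin_cases j <;> simp [sym]
  · fin_cases i <;> fin_cases j <;> simp [sym, coord, htr, hs 1 0, hs 2 0, hs 2 1]

/-! ### The Cartan embedding and the charts -/

/-- The Cartan embedding `u SO(3) ↦ u uᵀ`. -/
def cartan : WuManifold → Mat :=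
  Quotient.lift (fun u : SU3 => (u : Mat) * (u : Mat)ᵀ) (by
    intro u v h
    obtain ⟨r, hr, hrv⟩ := QuotientGroup.leftRel_apply.1 h
    have hv : v = u * (u⁻¹ * v) := by group
    have h1 : (u⁻¹ * v : SU3).1 * (u⁻¹ * v : SU3).1ᵀ = 1 := by
      rw [hrv, ← Matrix.transpose_map, ← Matrix.map_mul, (Matrix.mem_orthogonalGroup_iff (Fin 3) ℝ).1 hr.1]
      simp
    have h2 : (v : Mat) = (u : Mat) * (u⁻¹ * v : SU3).1 := by
      conv_lhs => rw [hv]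
      rfl
    show (u : Mat) * (u : Mat)ᵀ = (v : Mat) * (v : Mat)ᵀ
    rw [h2, Matrix.transpose_mul, Matrix.mul_assoc, ← Matrix.mul_assoc _ _ (u : Mat)ᵀ, h1,
      Matrix.one_mul])

lemma cartan_proj (u : SU3) : cartan (proj u) = (u : Mat) * (u : Mat)ᵀ := rfl

lemma continuous_cartan : Continuous cartan := by
  refine Continuous.quotient_lift ?_ _
  fun_prop

lemma cartan_injective : Function.Injective cartan := by
  intro p q
  induction p using QuotientGroup.induction_on with | H u => ?_
  induction q using QuotientGroup.induction_on with | H v => ?_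
  intro h
  replace h : (u : Mat) * (u : Mat)ᵀ = (v : Mat) * (v : Mat)ᵀ := h
  refine QuotientGroup.eq.2 ?_
  set w : SU3 := u⁻¹ * v with hw
  have hwc : (w : Mat) = (u : Mat)ᴴ * (v : Mat) := rfl
  have hwt : (w : Mat) * (w : Mat)ᵀ = 1 := by
    rw [hwc, Matrix.transpose_mul, Matrix.mul_assoc, ← Matrix.mul_assoc _ (v : Mat)ᵀ, ← h,
      ← Matrix.mul_assoc, ← Matrix.mul_assoc, SU3.conjTranspose_mul, Matrix.one_mul,
      ← Matrix.transpose_mul, SU3.conjTranspose_mul, Matrix.transpose_one]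
  have hreal : (w : Mat)ᵀ = (w : Mat)ᴴ := by
    calc (w : Mat)ᵀ = ((w : Mat)ᴴ * (w : Mat)) * (w : Mat)ᵀ := by
          rw [SU3.conjTranspose_mul, Matrix.one_mul]
      _ = (w : Mat)ᴴ := by rw [Matrix.mul_assoc, hwt, Matrix.mul_one]
  have him : ∀ i j, ((w : Mat) i j).im = 0 := by
    intro i j
    have := congrFun (congrFun hreal j) i
    rw [Matrix.transpose_apply, Matrix.conjTranspose_apply] at this
    exact Complex.conj_eq_iff_im.1 this.symm
  set r : Matrix (Fin 3) (Fin 3) ℝ := (w : Mat).map Complex.re with hr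
  have hwr : (w : Mat) = r.map (algebraMap ℝ ℂ) := by
    ext i j
    apply Complex.ext <;> simp [hr, him]
  have hinj : Function.Injective (fun A : Matrix (Fin 3) (Fin 3) ℝ => A.map (algebraMap ℝ ℂ)) :=
    Matrix.map_injective (algebraMap ℝ ℂ).injective
  refine ⟨r, Matrix.mem_specialOrthogonalGroup_iff.2
    ⟨(Matrix.mem_orthogonalGroup_iff (Fin 3) ℝ).2 (hinj ?_), ?_⟩, hwr⟩
  · show (r * rᵀ).map (algebraMap ℝ ℂ) = (1 : Matrix (Fin 3) (Fin 3) ℝ).map (algebraMap ℝ ℂ)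
    rw [Matrix.map_mul, Matrix.transpose_map, ← hwr, hwt]
    simp
  · have hd := SU3.det w
    rw [hwr] at hd
    have h2 : ((r.det : ℝ) : ℂ) = 1 := by
      rw [← hd]
      exact RingHom.map_det (algebraMap ℝ ℂ) r
    exact_mod_cast h2


section Log

attribute [local instance] Matrix.linftyOpNormedRing Matrix.linftyOpNormedAlgebra

lemma exp_contDiff : ContDiff ℝ ω (NormedSpace.exp : Mat → Mat) :=
  contDiff_iff_contDiffAt.2 fun x => (NormedSpace.exp_analytic (𝕂 := ℝ) x).contDiffAt

/-- A local inverse of the matrix exponential near `0`. -/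
lemma exists_log : ∃ L : OpenPartialHomeomorph Mat Mat, (0 : Mat) ∈ L.source ∧
    (∀ A ∈ L.source, L A = NormedSpace.exp A) ∧ ContDiffOn ℝ ω L.symm L.target ∧
    ∀ A ∈ L.source, NormedSpace.exp A ∈ Matrix.specialUnitaryGroup (Fin 3) ℂ →
      (NormedSpace.exp A)ᵀ = NormedSpace.exp A → Aᵀ = A ∧ Aᴴ = -A ∧ A.trace = 0 := by
  have hd : HasFDerivAt (NormedSpace.exp : Mat → Mat)
      ((ContinuousLinearEquiv.refl ℝ Mat : Mat ≃L[ℝ] Mat) : Mat →L[ℝ] Mat) 0 :=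
    hasFDerivAt_exp_zero (𝕂 := ℝ) (𝔸 := Mat)
  have hc : ContDiffAt ℝ ω (NormedSpace.exp : Mat → Mat) 0 := exp_contDiff.contDiffAt
  set e := hc.toOpenPartialHomeomorph _ hd (by simp) with he
  have hecoe : ∀ A, e A = NormedSpace.exp A := fun A => rfl
  have h0 : (0 : Mat) ∈ e.source := hc.mem_toOpenPartialHomeomorph_source hd (by simp)
  have hsymm : ContDiffAt ℝ ω e.symm (e 0) :=
    e.contDiffAt_symm (e.map_source h0) (by rw [e.left_inv h0]; exact hd)
      (by rw [e.left_inv h0]; exact hc)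
  obtain ⟨N, hN, hNs⟩ : ∃ N ∈ 𝓝 (e 0), ContDiffOn ℝ ω e.symm N := by
    obtain ⟨N, hN, h⟩ := hsymm.contDiffOn le_rfl (by simp)
    exact ⟨N, hN, h⟩
  obtain ⟨N', hN'N, hN'o, hN'0⟩ := mem_nhds_iff.1 hN
  set V : Set Mat := (e.source ∩ e ⁻¹' N') ∩ ((fun A : Mat => Aᵀ) ⁻¹' e.source ∩
    ((fun A : Mat => -Aᴴ) ⁻¹' e.source ∩ {A : Mat | ‖A.trace‖ < 1})) with hV
  have hVo : IsOpen V := by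
    refine (e.isOpen_inter_preimage hN'o).inter ((e.open_source.preimage ?_).inter
      ((e.open_source.preimage ?_).inter (isOpen_lt ?_ ?_))) <;> fun_prop
  have hV0 : (0 : Mat) ∈ V := by
    refine ⟨⟨h0, hN'0⟩, ?_, ?_, ?_⟩ <;> simp [h0]
  refine ⟨e.restrOpen V hVo, ⟨h0, hV0⟩, fun A _ => rfl, ?_, ?_⟩
  · refine hNs.mono fun A hA => hN'N ?_
    have h1 := (e.restrOpen V hVo).map_target hA
    have h2 : e ((e.restrOpen V hVo).symm A) = A := (e.restrOpen V hVo).right_inv hA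
    have h3 : e ((e.restrOpen V hVo).symm A) ∈ N' := h1.2.1.2
    rwa [h2] at h3
  · rintro A ⟨hA, hA1, hAt, hAs, htr⟩ hSU hsym
    have hu : NormedSpace.exp A * (NormedSpace.exp A)ᴴ = 1 := Matrix.mem_unitaryGroup_iff.1 hSU.1
    have e1 : Aᵀ = A := e.injOn hAt hA (by
      show NormedSpace.exp Aᵀ = NormedSpace.exp A
      rw [Matrix.exp_transpose, hsym])
    have e2 : -Aᴴ = A := e.injOn hAs hA (by
      show NormedSpace.exp (-Aᴴ) = NormedSpace.exp A
      rw [Matrix.exp_neg, Matrix.exp_conjTranspose]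
      exact Matrix.inv_eq_left_inv hu)
    have e2' : Aᴴ = -A := by rw [eq_neg_iff_add_eq_zero, add_comm, ← sub_neg_eq_add, e2, sub_self]
    refine ⟨e1, e2', ?_⟩
    have hdet : Complex.exp A.trace = 1 := by rw [← det_exp_of_skew e2']; exact hSU.2
    obtain ⟨k, hk⟩ := Complex.exp_eq_one_iff.1 hdet
    have htr' : ‖A.trace‖ < 1 := htr
    by_cases hk0 : k = 0
    · rw [hk, hk0]; simp
    · exfalso
      rw [hk] at htr'
      simp only [norm_mul, Complex.norm_intCast, Complex.norm_I, Complex.norm_real, mul_one,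
        Complex.norm_ofNat, Real.norm_eq_abs, abs_of_pos Real.pi_pos] at htr'
      have : (1 : ℝ) ≤ |(k : ℝ)| := by exact_mod_cast Int.one_le_abs hk0
      nlinarith [Real.pi_gt_three]


/-- A chosen local inverse of the matrix exponential near `0`. -/
def logMat : OpenPartialHomeomorph Mat Mat := exists_log.choose

lemma zero_mem_logMat : (0 : Mat) ∈ logMat.source := exists_log.choose_spec.1

lemma logMat_apply {A : Mat} (h : A ∈ logMat.source) : logMat A = NormedSpace.exp A :=
  exists_log.choose_spec.2.1 A h

lemma contDiffOn_logMat_symm : ContDiffOn ℝ ω logMat.symm logMat.target :=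
  exists_log.choose_spec.2.2.1

lemma logMat_spec {A : Mat} (h : A ∈ logMat.source)
    (h1 : NormedSpace.exp A ∈ Matrix.specialUnitaryGroup (Fin 3) ℂ)
    (h2 : (NormedSpace.exp A)ᵀ = NormedSpace.exp A) : Aᵀ = A ∧ Aᴴ = -A ∧ A.trace = 0 :=
  exists_log.choose_spec.2.2.2 A h h1 h2

lemma continuous_exp : Continuous (NormedSpace.exp : Mat → Mat) := exp_contDiff.continuous

lemma sym_contDiff : ContDiff ℝ ω (fun x : E 5 => (sym x : Mat)) :=
  (LinearMap.toContinuousLinearMap (su3.subtype ∘ₗ sym)).contDiff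

lemma continuous_sym : Continuous (fun x : E 5 => (sym x : Mat)) := sym_contDiff.continuous

end Log


/-- The symmetric unitary matrix `u⁻¹ · (Cartan embedding of q) · u⁻ᵀ`. -/
def pull (u : SU3) (q : WuManifold) : Mat := (u : Mat)ᴴ * cartan q * ((u : Mat)ᴴ)ᵀ

lemma continuous_pull (u : SU3) : Continuous (pull u) := by
  have := continuous_cartan
  unfold pull
  fun_prop

lemma pull_proj (u v : SU3) :
    pull u (proj v) = ((u⁻¹ * v : SU3) : Mat) * ((u⁻¹ * v : SU3) : Mat)ᵀ := by
  have : ((u⁻¹ * v : SU3) : Mat) = (u : Mat)ᴴ * (v : Mat) := rfl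
  rw [pull, cartan_proj, this, Matrix.transpose_mul]
  simp only [Matrix.mul_assoc]

lemma pull_mem (u : SU3) (q : WuManifold) :
    pull u q ∈ Matrix.specialUnitaryGroup (Fin 3) ℂ ∧ (pull u q)ᵀ = pull u q := by
  induction q using QuotientGroup.induction_on with | H v => ?_
  have h := pull_proj u v
  rw [proj] at h
  rw [h]
  set w := u⁻¹ * v
  refine ⟨mem_SU3 ?_ ?_, by rw [Matrix.transpose_mul, Matrix.transpose_transpose]⟩
  · have h1 : (w : Mat)ᵀ * ((w : Mat)ᵀ)ᴴ = 1 := by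
      have := congrArg Matrix.transpose (SU3.conjTranspose_mul w)
      rw [Matrix.transpose_mul, Matrix.transpose_one] at this
      exact this
    rw [Matrix.conjTranspose_mul, Matrix.mul_assoc, ← Matrix.mul_assoc _ _ (w : Mat)ᴴ, h1,
      Matrix.one_mul, SU3.mul_conjTranspose]
  · rw [Matrix.det_mul, Matrix.det_transpose, SU3.det, one_mul]

lemma pull_injective (u : SU3) : Function.Injective (pull u) := by
  have h2 : (u : Mat)ᵀ * ((u : Mat)ᴴ)ᵀ = 1 := by
    rw [← Matrix.transpose_mul, SU3.conjTranspose_mul, Matrix.transpose_one]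
  have h3 : ((u : Mat)ᴴ)ᵀ * (u : Mat)ᵀ = 1 := by
    rw [← Matrix.transpose_mul, SU3.mul_conjTranspose, Matrix.transpose_one]
  have key : ∀ q, cartan q = (u : Mat) * pull u q * (u : Mat)ᵀ := by
    intro q
    rw [pull, Matrix.mul_assoc, Matrix.mul_assoc _ _ (u : Mat)ᵀ, h3, Matrix.mul_one,
      ← Matrix.mul_assoc, SU3.mul_conjTranspose, Matrix.one_mul]
  intro p q h
  exact cartan_injective (by rw [key p, key q, h])

lemma exp_sym_sq (x : E 5) :
    (expSU (sym x) : Mat) * (expSU (sym x) : Mat)ᵀ = NormedSpace.exp ((2 : ℝ) • (sym x : Mat)) := by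
  show NormedSpace.exp (sym x : Mat) * (NormedSpace.exp (sym x : Mat))ᵀ = _
  rw [← Matrix.exp_transpose, sym_transpose, two_smul, Matrix.exp_add_of_commute _ _ (Commute.refl _)]

lemma pull_chart (u : SU3) (x : E 5) :
    pull u (proj (u * expSU (sym x))) = NormedSpace.exp ((2 : ℝ) • (sym x : Mat)) := by
  rw [pull_proj, inv_mul_cancel_left, exp_sym_sq]

/-- Chart of `SU(3)/SO(3)` at `u SO(3)`: the inverse of `x ↦ u exp(i S(x)) SO(3)`, where `S(x)`
runs through a neighbourhood of `0` in the real symmetric trace-free matrices. -/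
def expChart (u : SU3) : OpenPartialHomeomorph WuManifold (E 5) where
  toFun q := coord ((2 : ℝ)⁻¹ • logMat.symm (pull u q))
  invFun x := proj (u * expSU (sym x))
  source := pull u ⁻¹' logMat.target
  target := (fun x => (2 : ℝ) • (sym x : Mat)) ⁻¹' logMat.source
  map_source' := by
    intro q hq
    have hA := logMat.map_target hq
    have hr := logMat.right_inv hq
    rw [logMat_apply hA] at hr
    obtain ⟨h1, h2⟩ := pull_mem u q
    obtain ⟨a1, a2, a3⟩ := logMat_spec hA (by rw [hr]; exact h1) (by rw [hr]; exact h2)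
    have : (sym (coord ((2 : ℝ)⁻¹ • logMat.symm (pull u q))) : Mat)
        = (2 : ℝ)⁻¹ • logMat.symm (pull u q) := by
      apply sym_coord
      · rw [Matrix.transpose_smul, a1]
      · rw [Matrix.conjTranspose_smul, a2]; simp
      · rw [Matrix.trace_smul, a3, smul_zero]
    rw [Set.mem_preimage, this, smul_inv_smul₀ (two_ne_zero)]
    exact hA
  map_target' := by
    intro x hx
    rw [Set.mem_preimage, pull_chart, ← logMat_apply hx]
    exact logMat.map_source hx
  left_inv' := by
    intro q hq
    have hA := logMat.map_target hq
    have hr := logMat.right_inv hq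
    rw [logMat_apply hA] at hr
    obtain ⟨h1, h2⟩ := pull_mem u q
    obtain ⟨a1, a2, a3⟩ := logMat_spec hA (by rw [hr]; exact h1) (by rw [hr]; exact h2)
    have : (sym (coord ((2 : ℝ)⁻¹ • logMat.symm (pull u q))) : Mat)
        = (2 : ℝ)⁻¹ • logMat.symm (pull u q) := by
      apply sym_coord
      · rw [Matrix.transpose_smul, a1]
      · rw [Matrix.conjTranspose_smul, a2]; simp
      · rw [Matrix.trace_smul, a3, smul_zero]
    apply pull_injective u
    rw [pull_chart, this, smul_inv_smul₀ (two_ne_zero), hr]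
  right_inv' := by
    intro x hx
    show coord ((2 : ℝ)⁻¹ • logMat.symm (pull u (proj (u * expSU (sym x))))) = x
    rw [pull_chart, ← logMat_apply hx, logMat.left_inv hx, inv_smul_smul₀ (two_ne_zero), coord_sym]
  open_source := logMat.open_target.preimage (continuous_pull u)
  open_target := logMat.open_source.preimage (Continuous.const_smul (g := fun x => (sym x : Mat)) continuous_sym (2 : ℝ))
  continuousOn_toFun := by
    have h1 : ContinuousOn (fun q => logMat.symm (pull u q)) (pull u ⁻¹' logMat.target) :=
      logMat.symm.continuousOn.comp (continuous_pull u).continuousOn fun q hq => hq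
    have h2 : Continuous coord := by unfold coord; fun_prop
    exact h2.comp_continuousOn (ContinuousOn.const_smul (g := fun q => logMat.symm (pull u q)) h1 (2 : ℝ)⁻¹)
  continuousOn_invFun := by
    have h1 : Continuous fun x : E 5 => expSU (sym x) :=
      (continuous_exp.comp continuous_sym).subtype_mk _
    have h2 : Continuous proj := continuous_quotient_mk'
    have h3 : Continuous fun v : SU3 => u * v :=
      (Continuous.matrix_mul continuous_const continuous_subtype_val).subtype_mk _
    exact (h2.comp (h3.comp h1)).continuousOn

lemma mem_expChart_source (u : SU3) : proj u ∈ (expChart u).source := by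
  change pull u (proj u) ∈ logMat.target
  have h : pull u (proj u) = logMat 0 := by
    rw [pull_proj, inv_mul_cancel, logMat_apply zero_mem_logMat, NormedSpace.exp_zero]
    simp
  rw [h]
  exact logMat.map_source zero_mem_logMat

/-- The smooth atlas of `SU(3)/SO(3)`. -/
instance : ChartedSpace (E 5) WuManifold where
  atlas := Set.range expChart
  chartAt q := expChart q.out
  mem_chart_source q := by
    have h := mem_expChart_source q.out
    have h2 : proj q.out = q := QuotientGroup.out_eq' q
    rwa [h2] at h
  chart_mem_atlas q := ⟨_, rfl⟩

section Compat

attribute [local instance] Matrix.linftyOpNormedRing Matrix.linftyOpNormedAlgebra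

instance : IsManifold (𝓡 5) ω WuManifold := by
  refine isManifold_of_contDiffOn _ _ _ ?_
  rintro _ _ ⟨u, rfl⟩ ⟨v, rfl⟩
  have hs : ContDiff ℝ ω (fun x : E 5 => pull v (proj (u * expSU (sym x)))) := by
    have h1 : ContDiff ℝ ω (fun x : E 5 => NormedSpace.exp ((2 : ℝ) • (sym x : Mat))) :=
      exp_contDiff.comp (sym_contDiff.const_smul (2 : ℝ))
    have h2 : ∀ x : E 5, pull v (proj (u * expSU (sym x)))
        = ((v : Mat)ᴴ * (u : Mat)) * NormedSpace.exp ((2 : ℝ) • (sym x : Mat))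
          * ((v : Mat)ᴴ * (u : Mat))ᵀ := by
      intro x
      rw [pull_proj, ← exp_sym_sq]
      have : ((v⁻¹ * (u * expSU (sym x)) : SU3) : Mat)
          = ((v : Mat)ᴴ * (u : Mat)) * (expSU (sym x) : Mat) := by
        rw [Matrix.mul_assoc]; rfl
      rw [this, Matrix.transpose_mul]
      simp only [Matrix.mul_assoc]
    simp_rw [h2]
    exact (contDiff_const.mul h1).mul contDiff_const
  have hc : ContDiff ℝ ω coord := by
    have : IsLinearMap ℝ coord := by
      constructor <;> intros <;> ext i <;> fin_cases i <;> simp [coord]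
    exact (LinearMap.toContinuousLinearMap this.mk').contDiff
  have hmain : ContDiffOn ℝ ω
      (fun x : E 5 => coord ((2 : ℝ)⁻¹ • logMat.symm (pull v (proj (u * expSU (sym x))))))
      ((fun x : E 5 => pull v (proj (u * expSU (sym x)))) ⁻¹' logMat.target) :=
    hc.comp_contDiffOn ((contDiffOn_logMat_symm.comp hs.contDiffOn fun x hx => hx).const_smul _)
  refine hmain.mono ?_
  rintro x ⟨hx, -⟩
  exact hx.2

end Compat

/-! ### The Riemannian submersion metric -/

/-- An inner product on `𝔰𝔲(3)` that is invariant under `Ad`. Its left translates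
`⟨u X, u Y⟩_u = B X Y` form a bi-invariant Riemannian metric on `SU(3)`, and every bi-invariant
metric is of this form. -/
structure IsBiInvariant (B : LinearMap.BilinForm ℝ su3) : Prop where
  symm : ∀ X Y, B X Y = B Y X
  pos : ∀ X, X ≠ 0 → 0 < B X X
  ad : ∀ (u : SU3) (X Y : su3), B (Ad u X) (Ad u Y) = B X Y

/-- The differential of `π` at `u`, applied to the tangent vector `u X` of `SU(3)` with
`X ∈ 𝔰𝔲(3)`: the velocity at `t = 0` of the curve `π (u exp (t X))`. -/
def projDeriv (u : SU3) (X : su3) : TangentSpace (𝓡 5) (proj u) :=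
  mfderiv 𝓘(ℝ, ℝ) (𝓡 5) (fun t : ℝ => proj (u * expSU (t • X))) 0 (1 : ℝ)

/-- `X` is horizontal at `u`: `u X` is orthogonal to the kernel of `dπ_u`. -/
def IsHorizontal (B : LinearMap.BilinForm ℝ su3) (u : SU3) (X : su3) : Prop :=
  ∀ Z : su3, projDeriv u Z = 0 → B Z X = 0

end

end Wu

namespace Riem

noncomputable section

open Bundle

/-- A smooth Riemannian metric on a smooth `n`-manifold `M`. -/
abbrev Metric (n : ℕ) (M : Type*) [TopologicalSpace M] [ChartedSpace (EuclideanSpace ℝ (Fin n)) M]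
    [IsManifold (𝓡 n) ∞ M] : Type _ :=
  ContMDiffRiemannianMetric (𝓡 n) ∞ (EuclideanSpace ℝ (Fin n))
    (fun x : M => TangentSpace (𝓡 n) x)

variable {n : ℕ} {M : Type*} [TopologicalSpace M] [ChartedSpace (EuclideanSpace ℝ (Fin n)) M]
  [IsManifold (𝓡 n) ∞ M]

/-- The partial derivative `∂ₖ f` at `x`. -/
def pd (k : Fin n) (f : EuclideanSpace ℝ (Fin n) → ℝ) (x : EuclideanSpace ℝ (Fin n)) : ℝ :=
  fderiv ℝ f x (EuclideanSpace.single k 1)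

/-- The coordinate vector field `∂ᵢ` of the preferred chart at `p`, at the point with
coordinates `x`. -/
def coordField (p : M) (x : EuclideanSpace ℝ (Fin n)) (i : Fin n) :
    TangentSpace (𝓡 n) ((chartAt (EuclideanSpace ℝ (Fin n)) p).symm x) :=
  mfderiv (𝓡 n) (𝓡 n) (chartAt (EuclideanSpace ℝ (Fin n)) p).symm x (EuclideanSpace.single i (1 : ℝ))

/-- The coefficients `gᵢⱼ` of the metric in the preferred chart at `p`. -/
def gram (g : Metric n M) (p : M) (x : EuclideanSpace ℝ (Fin n)) : Matrix (Fin n) (Fin n) ℝ :=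
  Matrix.of fun i j => g.inner _ (coordField p x i) (coordField p x j)

/-- The Christoffel symbols `Γᵏᵢⱼ` of the Levi-Civita connection in the preferred chart at `p`. -/
def christoffel (g : Metric n M) (p : M) (k i j : Fin n) (x : EuclideanSpace ℝ (Fin n)) : ℝ :=
  (1 / 2) * ∑ l, (gram g p x)⁻¹ k l *
    (pd i (fun y => gram g p y j l) x + pd j (fun y => gram g p y i l) x
      - pd l (fun y => gram g p y i j) x)

/-- The components of the curvature tensor: `R(∂ᵢ, ∂ⱼ) ∂ₖ = ∑ₗ (curvatureCoeff l i j k) ∂ₗ`, where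
`R(X, Y) Z = ∇_X ∇_Y Z - ∇_Y ∇_X Z - ∇_[X,Y] Z`. -/
def curvatureCoeff (g : Metric n M) (p : M) (l i j k : Fin n) (x : EuclideanSpace ℝ (Fin n)) : ℝ :=
  pd i (christoffel g p l j k) x - pd j (christoffel g p l i k) x
    + ∑ m, (christoffel g p m j k x * christoffel g p l i m x
      - christoffel g p m i k x * christoffel g p l j m x)

/-- The components of a tangent vector at `p` in the preferred chart at `p` (through which Mathlib
identifies `T_p M` with `ℝⁿ`). -/
def comp {p : M} (X : TangentSpace (𝓡 n) p) : EuclideanSpace ℝ (Fin n) := X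

/-- The curvature tensor `R(X, Y) Z` at `p`. -/
def curvature (g : Metric n M) (p : M) (X Y Z : TangentSpace (𝓡 n) p) : TangentSpace (𝓡 n) p :=
  (WithLp.toLp 2 fun l => ∑ i, ∑ j, ∑ k,
    curvatureCoeff g p l i j k (chartAt (EuclideanSpace ℝ (Fin n)) p p) *
      comp X i * comp Y j * comp Z k : EuclideanSpace ℝ (Fin n))

/-- The sectional curvature of the plane spanned by two linearly independent vectors. -/
def sec (g : Metric n M) (p : M) (X Y : TangentSpace (𝓡 n) p) : ℝ :=
  g.inner p (curvature g p X Y Y) X / (g.inner p X X * g.inner p Y Y - g.inner p X Y ^ 2)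

/-- The Grassmannian of 2-planes in `T_p M`. -/
abbrev Plane (n : ℕ) {M : Type*} [TopologicalSpace M] [ChartedSpace (EuclideanSpace ℝ (Fin n)) M]
    (p : M) : Type _ :=
  {σ : Submodule ℝ (TangentSpace (𝓡 n) p) // Module.finrank ℝ σ = 2}

/-- A basis of a 2-plane. -/
def Plane.basis {p : M} (σ : Plane n p) : Module.Basis (Fin 2) ℝ σ.1 :=
  haveI : Module.Finite ℝ σ.1 := Module.finite_of_finrank_eq_succ σ.2
  Module.finBasisOfFinrankEq ℝ σ.1 σ.2

/-- The sectional curvature of a 2-plane (it does not depend on the basis). -/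
def secPlane (g : Metric n M) (p : M) (σ : Plane n p) : ℝ :=
  sec g p (σ.basis 0 : TangentSpace (𝓡 n) p) (σ.basis 1 : TangentSpace (𝓡 n) p)

/-- `σ' ⊂ σ^⊥`. -/
def Orthogonal (g : Metric n M) (p : M) (σ σ' : Plane n p) : Prop :=
  ∀ X ∈ σ.1, ∀ Y ∈ σ'.1, g.inner p X Y = 0

/-- The biorthogonal curvature of a 2-plane `σ`: the minimum of the averages
`(sec σ + sec σ') / 2` over all 2-planes `σ' ⊂ σ^⊥`. -/
def biorthogonalCurvature (g : Metric n M) (p : M) (σ : Plane n p) : ℝ :=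
  sInf {c : ℝ | ∃ σ' : Plane n p, Orthogonal g p σ σ' ∧
    c = (1 / 2) * (secPlane g p σ + secPlane g p σ')}

/-- `g` has positive biorthogonal curvature. -/
def HasPositiveBiorthogonalCurvature (g : Metric n M) : Prop :=
  ∀ (p : M) (σ : Plane n p), 0 < biorthogonalCurvature g p σ

end

end Riem

namespace Wu

/-- `g` is the metric on `SU(3)/SO(3)` for which `π` is a Riemannian submersion, `SU(3)` carrying
the bi-invariant metric given by `B`: every `dπ_u` is surjective, and is isometric on the
orthogonal complement of its kernel. -/
structure IsSymmetricSpaceMetric (B : LinearMap.BilinForm ℝ su3) (g : Riem.Metric 5 WuManifold) :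
    Prop where
  surjective : ∀ u : SU3, Function.Surjective (projDeriv u)
  isometry : ∀ (u : SU3) (X Y : su3), IsHorizontal B u X → IsHorizontal B u Y →
    g.inner (proj u) (projDeriv u X) (projDeriv u Y) = B X Y

end Wu

/-! At every point of SU(3)/SO(3) the tangent space is modelled on the matrices `i S`, with `S` real
symmetric and trace-free.

Metric. Every `Ad`-invariant inner product is `-(c/2) Re tr(XY)` with `c > 0`
(`IsBiInvariant.exists_trace`). The kernel of `dπ_u` consists of the skew-symmetric `X`, so
horizontal means symmetric (`isHorizontal_iff`), and horizontal vectors reach every tangent vector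
(`exists_horizontal`). The submersion condition therefore prescribes all values of `g`, which is
uniqueness (`IsSymmetricSpaceMetric.eq`). For existence, let `C` be the Cartan embedding `u SO(3) ↦
u uᵀ`: its right logarithmic derivative along a horizontal `X` is `2 Ad_u X`, so `-(c/8) Re tr(dC C*
dC C*)` has the right values, and it is visibly smooth.

Curvature. In the exponential chart the Gram matrix does not depend on the centre: it is a constant
times `Re tr(∂ᵢ exp L · ∂ⱼ exp(-L))` with `L` linear. Cyclicity of the trace makes its first
derivatives vanish at the origin and turns the second ones into traces of products of commutators
(`dirD_dirD_gramExp_zero`). The coordinate formula for the curvature then gives `sec = (2/c)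
‖[S,T]‖² / (‖S‖²‖T‖² - ⟨S,T⟩²)` (`sec_symR`). This is nonnegative, and zero exactly on planes of
commuting matrices.

Positivity. A commuting plane contains a matrix with eigenvalues `λ, 0, -λ`, `λ ≠ 0`; in its
eigenbasis the plane consists of all trace-free diagonal matrices. The orthogonal matrices then have
zero diagonal, and on those the commutator is a cross product, so every orthogonal plane has
curvature exactly `1/c` (`commSq_eq_of_flat`). Hence the averages are at least `sec σ / 2 > 0` when
`σ` is not flat, and at least `1/(2c)` when it is. Both bounds are uniform in `σ'`, so they pass to
the infimum. -/

namespace Wu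

/-! ### `Ad`-invariant inner products on `𝔰𝔲(3)` -/

/-- Coordinates on `𝔰𝔲(3)`. -/
noncomputable def par : (Fin 8 → ℝ) →ₗ[ℝ] su3 where
  toFun x := ⟨!![Complex.I * x 0, x 5 + Complex.I * x 2, x 6 + Complex.I * x 3;
      -x 5 + Complex.I * x 2, Complex.I * x 1, x 7 + Complex.I * x 4;
      -x 6 + Complex.I * x 3, -x 7 + Complex.I * x 4, -(Complex.I * x 0) - Complex.I * x 1], by
    refine ⟨?_, ?_⟩
    · ext i j
      fin_cases i <;> fin_cases j <;> simp [Matrix.conjTranspose_apply] <;> ring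
    · simp [Matrix.trace_fin_three]⟩
  map_add' x y := by
    ext i j
    fin_cases i <;> fin_cases j <;> simp <;> ring
  map_smul' c x := by
    ext i j
    fin_cases i <;> fin_cases j <;> simp <;> ring

lemma par_coe (x : Fin 8 → ℝ) : (par x : Mat) =
    !![Complex.I * x 0, x 5 + Complex.I * x 2, x 6 + Complex.I * x 3;
      -x 5 + Complex.I * x 2, Complex.I * x 1, x 7 + Complex.I * x 4;
      -x 6 + Complex.I * x 3, -x 7 + Complex.I * x 4, -(Complex.I * x 0) - Complex.I * x 1] := rfl

lemma par_surjective : Function.Surjective par := by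
  rintro ⟨X, h1, h2⟩
  have e : ∀ i j, star (X j i) = -X i j := fun i j => congrFun (congrFun h1 i) j
  have er : ∀ i j, (X j i).re = -(X i j).re := fun i j => by
    simpa using congrArg Complex.re (e i j)
  have ei : ∀ i j, (X j i).im = (X i j).im := fun i j => by
    simpa using congrArg Complex.im (e i j)
  rw [Matrix.trace_fin_three] at h2
  have h2' : (X 2 2).im = -(X 0 0).im - (X 1 1).im := by
    have := congrArg Complex.im h2
    simp at this
    linarith
  have d : ∀ i, (X i i).re = 0 := fun i => by linarith [er i i]
  refine ⟨![(X 0 0).im, (X 1 1).im, (X 0 1).im, (X 0 2).im, (X 1 2).im, (X 0 1).re, (X 0 2).re,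
    (X 1 2).re], Subtype.ext ?_⟩
  rw [par_coe]
  ext i j
  apply Complex.ext
  · fin_cases i <;> fin_cases j <;> simp [d, er 0 1, er 0 2, er 1 2]
  · fin_cases i <;> fin_cases j <;> simp [h2', ei 0 1, ei 0 2, ei 1 2]

/-- A diagonal element of `SU(3)`. -/
noncomputable def diagSU (a b : unitary ℂ) : SU3 :=
  ⟨Matrix.diagonal ![(a : ℂ), b, star (a : ℂ) * star (b : ℂ)], by
    have ha := Unitary.mul_star_self_of_mem a.2
    have hb := Unitary.mul_star_self_of_mem b.2
    refine mem_SU3 ?_ ?_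
    · rw [Matrix.diagonal_conjTranspose, Matrix.diagonal_mul_diagonal, ← Matrix.diagonal_one]
      congr 1
      ext i
      fin_cases i
      · simpa using ha
      · simpa using hb
      · simp only [Fin.reduceFinMk, Matrix.cons_val, Pi.star_apply, star_mul, star_star]
        linear_combination ha * (b * star (b : ℂ)) + hb
    · simp only [Matrix.det_diagonal, Fin.prod_univ_three, Matrix.cons_val]
      linear_combination ha * (b * star (b : ℂ)) + hb⟩

/-- The cyclic permutation matrix. -/
noncomputable def cycSU : SU3 :=
  ⟨!![0, 0, 1; 1, 0, 0; 0, 1, 0], by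
    refine mem_SU3 ?_ ?_
    · ext i j
      fin_cases i <;> fin_cases j <;>
        simp [Matrix.mul_apply, Fin.sum_univ_three, Matrix.conjTranspose_apply]
    · simp [Matrix.det_fin_three]⟩

/-- The rotation by `π/4` in the first two coordinates. -/
noncomputable def rotSU : SU3 :=
  ⟨!![((√2 / 2 : ℝ) : ℂ), -((√2 / 2 : ℝ) : ℂ), 0; ((√2 / 2 : ℝ) : ℂ), ((√2 / 2 : ℝ) : ℂ), 0; 0, 0, 1], by
    have h : ((√2 / 2 : ℝ) : ℂ) * ((√2 / 2 : ℝ) : ℂ) = 1 / 2 := by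
      have := Real.mul_self_sqrt (show (0 : ℝ) ≤ 2 by norm_num)
      rw [← Complex.ofReal_mul, show √2 / 2 * (√2 / 2) = 1 / 2 by linarith]
      simp
    generalize hc : ((√2 / 2 : ℝ) : ℂ) = c at h
    have hs : (starRingEnd ℂ) c = c := by rw [← hc]; exact Complex.conj_ofReal _
    refine mem_SU3 ?_ ?_
    · ext i j
      fin_cases i <;> fin_cases j <;>
        simp [Matrix.mul_apply, Fin.sum_univ_three, Matrix.conjTranspose_apply, hs, h] <;> norm_num
    · simp [Matrix.det_fin_three, h]; norm_num⟩

lemma Ad_coe (u : SU3) (X : su3) : (Ad u X : Mat) = (u : Mat) * (X : Mat) * (u : Mat)ᴴ := rfl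

/-- Together with `Ad_diag_neg_neg`, the signs separate the coordinate blocks `{0,1}`, `{2,5}`,
`{3,6}`, `{4,7}`: an invariant form has no cross terms between different blocks. -/
lemma Ad_diag_one_neg (x : Fin 8 → ℝ) :
    Ad (diagSU 1 (-1)) (par x) = par (![1, 1, -1, -1, 1, -1, -1, 1] * x) := by
  apply Subtype.ext
  rw [Ad_coe, par_coe, par_coe]
  simp only [diagSU, Matrix.diagonal_conjTranspose]
  ext i j
  rw [Matrix.mul_diagonal, Matrix.diagonal_mul]
  have h : ((-1 : unitary ℂ) : ℂ) = -1 := rfl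
  fin_cases i <;> fin_cases j <;> simp [h] <;> ring

lemma Ad_diag_neg_neg (x : Fin 8 → ℝ) :
    Ad (diagSU (-1) (-1)) (par x) = par (![1, 1, 1, -1, -1, 1, -1, -1] * x) := by
  apply Subtype.ext
  rw [Ad_coe, par_coe, par_coe]
  simp only [diagSU, Matrix.diagonal_conjTranspose]
  ext i j
  rw [Matrix.mul_diagonal, Matrix.diagonal_mul]
  have h : ((-1 : unitary ℂ) : ℂ) = -1 := rfl
  fin_cases i <;> fin_cases j <;> simp [h] <;> ring

/-- The imaginary unit, as a unitary number. -/
noncomputable def unitI : unitary ℂ := ⟨Complex.I, by simp [Unitary.mem_iff]⟩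

/-- Conjugation by `diag(i, 1, -i)` multiplies the entries (0,1) and (1,2) by `i`, a quarter turn in
the coordinate planes (2,5) and (4,7). An invariant form is therefore a multiple of the standard one
on each of these planes. -/
lemma Ad_diag_I_one (x : Fin 8 → ℝ) :
    Ad (diagSU unitI 1) (par x) = par ![x 0, x 1, x 5, -x 3, x 7, -x 2, -x 6, -x 4] := by
  apply Subtype.ext
  rw [Ad_coe, par_coe, par_coe]
  simp only [diagSU, Matrix.diagonal_conjTranspose, unitI]
  ext i j
  rw [Matrix.mul_diagonal, Matrix.diagonal_mul]
  fin_cases i <;> fin_cases j <;> apply Complex.ext <;> simp <;> ring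

lemma Ad_diag_one_I (x : Fin 8 → ℝ) :
    Ad (diagSU 1 unitI) (par x) = par ![x 0, x 1, -x 5, x 6, -x 4, x 2, -x 3, -x 7] := by
  apply Subtype.ext
  rw [Ad_coe, par_coe, par_coe]
  simp only [diagSU, Matrix.diagonal_conjTranspose, unitI]
  ext i j
  rw [Matrix.mul_diagonal, Matrix.diagonal_mul]
  fin_cases i <;> fin_cases j <;> apply Complex.ext <;> simp <;> ring

lemma Ad_cyc (x : Fin 8 → ℝ) :
    Ad cycSU (par x) = par ![-x 0 - x 1, x 0, x 3, x 4, x 2, -x 6, -x 7, x 5] := by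
  apply Subtype.ext
  rw [Ad_coe, par_coe, par_coe]
  simp only [cycSU]
  ext i j
  fin_cases i <;> fin_cases j <;> apply Complex.ext <;>
    simp [Matrix.mul_apply, Fin.sum_univ_three, Matrix.conjTranspose_apply]

/-- The link between the off-diagonal and the diagonal directions, which fixes the scale of the form
on the torus. -/
lemma Ad_rot (c : ℝ) :
    Ad rotSU (par ![0, 0, c, 0, 0, 0, 0, 0]) = par ![-c, c, 0, 0, 0, 0, 0, 0] := by
  apply Subtype.ext
  rw [Ad_coe, par_coe, par_coe]
  have h : (√2 / 2) * (√2 / 2) = 1 / 2 := by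
    have := Real.mul_self_sqrt (show (0 : ℝ) ≤ 2 by norm_num)
    linarith
  simp only [rotSU]
  generalize √2 / 2 = s at h
  ext i j
  fin_cases i <;> fin_cases j <;> apply Complex.ext <;>
    simp [Matrix.mul_apply, Fin.sum_univ_three, Matrix.conjTranspose_apply] <;>
    first | linear_combination (2 * c) * h | linear_combination (-2 * c) * h

lemma bilin_par_expand (β : LinearMap.BilinForm ℝ (Fin 8 → ℝ)) (x y : Fin 8 → ℝ) :
    β x y = ∑ i, ∑ j, x i * y j * β (Pi.single i 1) (Pi.single j 1) := by
  conv_lhs => rw [← Finset.univ_sum_single x, ← Finset.univ_sum_single y]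
  have h : ∀ (z : Fin 8 → ℝ) i, (Pi.single i (z i) : Fin 8 → ℝ) = z i • Pi.single i 1 := by
    intro z i
    rw [← Pi.single_smul, smul_eq_mul, mul_one]
  simp only [h, map_sum, map_smul, LinearMap.sum_apply, LinearMap.smul_apply, smul_eq_mul]
  simp only [Finset.mul_sum]
  rw [Finset.sum_comm]
  refine Finset.sum_congr rfl fun i _ => Finset.sum_congr rfl fun j _ => ?_
  ring

/-- Every `Ad`-invariant inner product on `𝔰𝔲(3)` is a negative multiple of the trace form. -/
lemma IsBiInvariant.exists_trace {B : LinearMap.BilinForm ℝ su3} (hB : IsBiInvariant B) :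
    ∃ c : ℝ, 0 < c ∧ ∀ X Y : su3, B X Y = -(c / 2) * ((X : Mat) * (Y : Mat)).trace.re := by
  set β : LinearMap.BilinForm ℝ (Fin 8 → ℝ) := B.compl₁₂ par par with hβ
  have hβa : ∀ x y, β x y = B (par x) (par y) := fun x y => rfl
  set m : Fin 8 → Fin 8 → ℝ := fun i j => β (Pi.single i 1) (Pi.single j 1) with hm
  have hsymm : ∀ i j, m i j = m j i := fun i j => hB.symm _ _
  have hflip : ∀ (ε : Fin 8 → ℝ) (u : SU3), (∀ x, Ad u (par x) = par (ε * x)) →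
      ∀ i j, ε i * ε j * m i j = m i j := by
    intro ε u h i j
    have h1 := hB.ad u (par (Pi.single i 1)) (par (Pi.single j 1))
    have h2 : ∀ i, ε * (Pi.single i 1 : Fin 8 → ℝ) = ε i • Pi.single i 1 := by
      intro i
      ext k
      by_cases hk : k = i
      · subst hk; simp
      · simp [hk]
    rw [h, h, h2, h2, map_smul, map_smul, map_smul, map_smul, LinearMap.smul_apply] at h1
    simp only [smul_eq_mul] at h1
    simp only [hm, hβa]
    linarith
  have hf1 := hflip _ _ Ad_diag_one_neg
  have hf2 := hflip _ _ Ad_diag_neg_neg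
  have hT : ∀ (T : (Fin 8 → ℝ) → (Fin 8 → ℝ)) (u : SU3), (∀ x, Ad u (par x) = par (T x)) →
      ∀ x y, β (T x) (T y) = β x y := by
    intro T u h x y
    rw [hβa, hβa, ← h, ← h, hB.ad]
  have hneg : ∀ {u : SU3} {T : (Fin 8 → ℝ) → (Fin 8 → ℝ)} (i j : Fin 8),
      (∀ x, Ad u (par x) = par (T x)) → T (Pi.single i 1) = -Pi.single j 1 →
      T (Pi.single j 1) = Pi.single i 1 → m i i = m j j ∧ m i j = 0 := by
    intro u T i j h h1 h2
    have a := hT T u h (Pi.single i 1) (Pi.single i 1)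
    have b := hT T u h (Pi.single i 1) (Pi.single j 1)
    rw [h1] at a
    rw [h1, h2] at b
    simp only [map_neg, LinearMap.neg_apply, neg_neg] at a b
    have := hsymm i j
    simp only [hm] at this ⊢
    exact ⟨a.symm, by linarith⟩
  obtain ⟨r1, r2⟩ := hneg 2 5 Ad_diag_I_one (by ext k; fin_cases k <;> simp)
    (by ext k; fin_cases k <;> simp)
  obtain ⟨r3, r4⟩ := hneg 4 7 Ad_diag_I_one (by ext k; fin_cases k <;> simp)
    (by ext k; fin_cases k <;> simp)
  obtain ⟨r5, r6⟩ := hneg 3 6 Ad_diag_one_I (by ext k; fin_cases k <;> simp)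
    (by ext k; fin_cases k <;> simp)
  have hcyc : ∀ {i : Fin 8} {y : Fin 8 → ℝ}, (fun x : Fin 8 → ℝ =>
      (![-x 0 - x 1, x 0, x 3, x 4, x 2, -x 6, -x 7, x 5] : Fin 8 → ℝ)) (Pi.single i 1) = y →
      β y y = m i i := by
    rintro i y rfl
    exact hT _ _ Ad_cyc (Pi.single i 1) (Pi.single i 1)
  have r7 : m 2 2 = m 3 3 := hcyc (by ext k; fin_cases k <;> simp)
  have r8 : m 3 3 = m 4 4 := hcyc (by ext k; fin_cases k <;> simp)
  have hexp : ∀ s t : ℝ, β (s • Pi.single 0 1 + t • Pi.single 1 1)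
      (s • Pi.single 0 1 + t • Pi.single 1 1) = s ^ 2 * m 0 0 + 2 * s * t * m 0 1 + t ^ 2 * m 1 1 := by
    intro s t
    have := hsymm 0 1
    simp only [hm] at this ⊢
    simp only [map_add, map_smul, LinearMap.add_apply, LinearMap.smul_apply, smul_eq_mul]
    linear_combination - s * t * this
  -- The cyclic permutation sends the first two basis vectors to `-e₀ + e₁` and `-e₀`. This gives `m
  -- 1 1 = 2 * m 0 1` and `m 0 0 = m 1 1`; the rotation in `r11` then identifies `m 0 0` with `m 2
  -- 2`.
  have r9 := (hexp (-1) 1).symm.trans (hcyc (i := 0) (by ext k; fin_cases k <;> simp))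
  have r10 := (hexp (-1) 0).symm.trans (hcyc (i := 1) (by ext k; fin_cases k <;> simp))
  have r11 : β ((-1 : ℝ) • Pi.single 0 1 + (1 : ℝ) • Pi.single 1 1)
      ((-1 : ℝ) • Pi.single 0 1 + (1 : ℝ) • Pi.single 1 1) = m 2 2 := by
    have h1 : (![0, 0, 1, 0, 0, 0, 0, 0] : Fin 8 → ℝ) = Pi.single 2 1 := by
      ext k; fin_cases k <;> simp
    have h2 : (![-1, 1, 0, 0, 0, 0, 0, 0] : Fin 8 → ℝ) =
        (-1 : ℝ) • Pi.single 0 1 + (1 : ℝ) • Pi.single 1 1 := by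
      ext k; fin_cases k <;> simp
    rw [← h2, hβa, ← Ad_rot, hB.ad, h1]
    rfl
  rw [hexp] at r11
  have hpos : 0 < m 2 2 := by
    refine hB.pos _ fun h => ?_
    have := congrArg (fun X : su3 => ((X : Mat) 0 1).im) h
    simp [par_coe] at this
  -- The third basis vector has `Re tr(X²) = -2`, so with the factor `-(c/2)` its squared length is
  -- `c` itself.
  refine ⟨m 2 2, hpos, fun X Y => ?_⟩
  have hM : ∀ i j, m i j = m 2 2 * (!![1, 1 / 2, 0, 0, 0, 0, 0, 0; 1 / 2, 1, 0, 0, 0, 0, 0, 0;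
      0, 0, 1, 0, 0, 0, 0, 0; 0, 0, 0, 1, 0, 0, 0, 0; 0, 0, 0, 0, 1, 0, 0, 0;
      0, 0, 0, 0, 0, 1, 0, 0; 0, 0, 0, 0, 0, 0, 1, 0; 0, 0, 0, 0, 0, 0, 0, 1] :
      Matrix (Fin 8) (Fin 8) ℝ) i j := by
    intro i j
    have a := hf1 i j
    have b := hf2 i j
    have d := hsymm i j
    clear_value m
    revert a b d
    fin_cases i <;> fin_cases j <;> simp <;> intros <;> linarith
  obtain ⟨x, rfl⟩ := par_surjective X
  obtain ⟨y, rfl⟩ := par_surjective Y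
  have e1 : B (par x) (par y) = ∑ i, ∑ j, x i * y j * m i j := bilin_par_expand β x y
  have e2 : ∑ i, ∑ j, x i * y j * m i j = m 2 2 * (x 0 * y 0 + x 1 * y 1
      + (x 0 * y 1 + x 1 * y 0) / 2 + x 2 * y 2 + x 3 * y 3 + x 4 * y 4 + x 5 * y 5 + x 6 * y 6
      + x 7 * y 7) := by
    have h : ∀ i, ∑ j, x i * y j * m i j = m 2 2 * x i * ![y 0 + y 1 / 2, y 0 / 2 + y 1, y 2, y 3,
        y 4, y 5, y 6, y 7] i := by
      intro i
      generalize m 2 2 = c at hM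
      simp only [hM]
      rw [Fin.sum_univ_eight]
      fin_cases i <;>
        simp only [Fin.zero_eta, Fin.mk_one, Fin.reduceFinMk, Matrix.of_apply, Matrix.cons_val] <;> ring
    simp only [h, Fin.sum_univ_eight, Matrix.cons_val]
    ring
  have e3 : ((par x : Mat) * (par y : Mat)).trace.re = -2 * (x 0 * y 0 + x 1 * y 1
      + (x 0 * y 1 + x 1 * y 0) / 2 + x 2 * y 2 + x 3 * y 3 + x 4 * y 4 + x 5 * y 5 + x 6 * y 6
      + x 7 * y 7) := by
    rw [par_coe, par_coe, Matrix.trace_fin_three]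
    simp only [Matrix.mul_apply, Fin.sum_univ_three]
    simp
    ring
  rw [e1, e2, e3]
  ring

/-! ### The Cartan embedding and its differential -/

noncomputable section

section Analysis

attribute [local instance] Matrix.linftyOpNormedRing Matrix.linftyOpNormedAlgebra

lemma contDiff_coord : ContDiff ℝ ω coord := by
  have : IsLinearMap ℝ coord := by
    constructor <;> intros <;> ext i <;> fin_cases i <;> simp [coord]
  exact (LinearMap.toContinuousLinearMap this.mk').contDiff

/-- The inclusion of the symmetric matrices, as a continuous linear map. -/
def symL : E 5 →L[ℝ] Mat := LinearMap.toContinuousLinearMap (su3.subtype ∘ₗ sym)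

lemma symL_apply (x : E 5) : symL x = (sym x : Mat) := rfl

lemma sym_injective : Function.Injective sym := fun x y h => by
  rw [← coord_sym x, ← coord_sym y, h]

/-- The Cartan embedding in the exponential chart centred at `u SO(3)`. -/
def cartanExp (u : SU3) (x : E 5) : Mat :=
  (u : Mat) * NormedSpace.exp ((2 : ℝ) • symL x) * (u : Mat)ᵀ

lemma cartan_mul_exp (u : SU3) (x : E 5) : cartan (proj (u * expSU (sym x))) = cartanExp u x := by
  rw [cartan_proj, cartanExp, symL_apply, ← exp_sym_sq]
  change ((u : Mat) * (expSU (sym x) : Mat)) * ((u : Mat) * (expSU (sym x) : Mat))ᵀ = _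
  rw [Matrix.transpose_mul]
  simp only [Matrix.mul_assoc]

lemma contDiff_cartanExp (u : SU3) : ContDiff ℝ ω (cartanExp u) :=
  (contDiff_const.mul (exp_contDiff.comp (symL.contDiff.const_smul (2 : ℝ)))).mul contDiff_const

lemma cartan_chartAt_symm (p : WuManifold) (x : E 5) :
    cartan ((chartAt (E 5) p).symm x) = cartanExp p.out x :=
  cartan_mul_exp _ _

lemma proj_out (p : WuManifold) : proj p.out = p := QuotientGroup.out_eq' p

lemma chartAt_self (p : WuManifold) : chartAt (E 5) p p = 0 := by
  change coord ((2 : ℝ)⁻¹ • logMat.symm (pull p.out p)) = 0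
  have h : pull p.out p = logMat 0 := by
    conv_lhs => rw [← proj_out p]
    rw [proj_out, ← proj_out p, pull_proj, proj_out, inv_mul_cancel, logMat_apply zero_mem_logMat,
      NormedSpace.exp_zero]
    simp
  rw [h, logMat.left_inv zero_mem_logMat, smul_zero]
  ext i
  fin_cases i <;> simp [coord]

/-- The space of matrices as a plain product space. -/
abbrev V : Type := Fin 3 → Fin 3 → ℂ

/-- The identity map from matrices to the product space. -/
def toV : Mat →L[ℝ] V :=
  LinearMap.toContinuousLinearMap ((Matrix.ofLinearEquiv ℝ).symm : Mat ≃ₗ[ℝ] V).toLinearMap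

/-- The identity map from the product space to matrices. -/
def ofV : V →L[ℝ] Mat :=
  LinearMap.toContinuousLinearMap (Matrix.ofLinearEquiv ℝ : V ≃ₗ[ℝ] Mat).toLinearMap

/-- The Cartan embedding, with values in a normed space. -/
def cartanV (p : WuManifold) : V := toV (cartan p)

/-- In the preferred chart the map reads `x ↦ u exp(2 i S(x)) uᵀ`. -/
lemma contMDiff_cartanV : ContMDiff (𝓡 5) 𝓘(ℝ, V) ∞ cartanV := by
  intro p
  rw [contMDiffAt_iff_source_of_mem_source (x' := p) (mem_chart_source _ p)]
  have : cartanV ∘ (extChartAt (𝓡 5) p).symm = fun x => toV (cartanExp p.out x) :=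
    funext fun x => congrArg toV (cartan_chartAt_symm p x)
  rw [this]
  exact (((toV.contDiff.comp (contDiff_cartanExp p.out)).of_le le_top).contMDiff _).contMDiffWithinAt

/-- The differential of the Cartan embedding. -/
def dCartanV (p : WuManifold) : E 5 →L[ℝ] V := mfderiv (𝓡 5) 𝓘(ℝ, V) cartanV p

/-- The differential of the Cartan embedding, with values in the matrices. -/
def dCartan (p : WuManifold) : E 5 →L[ℝ] Mat := ofV.comp (dCartanV p)

lemma hasFDerivAt_cartanExp_zero (u : SU3) : ∀ v, fderiv ℝ (cartanExp u) 0 v =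
    (u : Mat) * ((2 : ℝ) • symL v) * (u : Mat)ᵀ := by
  intro v
  have h1 : HasFDerivAt (fun x : E 5 => NormedSpace.exp ((2 : ℝ) • symL x))
      ((1 : Mat →L[ℝ] Mat).comp ((2 : ℝ) • symL)) 0 := by
    have h2 : HasFDerivAt (fun x : E 5 => (2 : ℝ) • symL x) ((2 : ℝ) • symL) 0 :=
      ((2 : ℝ) • symL).hasFDerivAt
    refine HasFDerivAt.comp (g := NormedSpace.exp) (0 : E 5) ?_ h2
    rw [map_zero, smul_zero]
    exact hasFDerivAt_exp_zero
  have h := (h1.const_mul (u : Mat)).mul_const' (u : Mat)ᵀ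
  have e : fderiv ℝ (cartanExp u) 0 = _ := h.fderiv
  rw [e]
  rfl

/-- The preferred chart at `p` sends `p` to `0`, and the derivative of the exponential at `0` is the
identity; the factor 2 comes from squaring `exp(i S)`. -/
lemma dCartan_apply (p : WuManifold) (v : E 5) :
    dCartan p v = (p.out : Mat) * ((2 : ℝ) • symL v) * (p.out : Mat)ᵀ := by
  have hd : MDifferentiableAt (𝓡 5) 𝓘(ℝ, V) cartanV p :=
    (contMDiff_cartanV p).mdifferentiableAt (by simp)
  have hV : dCartanV p = fderiv ℝ (fun x => toV (cartanExp p.out x)) 0 := by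
    rw [dCartanV, hd.mfderiv]
    have h1 : writtenInExtChartAt (𝓡 5) 𝓘(ℝ, V) p cartanV = fun x => toV (cartanExp p.out x) :=
      funext fun x => congrArg toV (cartan_chartAt_symm p x)
    have h2 : extChartAt (𝓡 5) p p = 0 := chartAt_self p
    rw [h1, h2]
    simp only [modelWithCornersSelf_coe, Set.range_id, fderivWithin_univ]
  have h3 : fderiv ℝ (fun x => toV (cartanExp p.out x)) 0 =
      toV.comp (fderiv ℝ (cartanExp p.out) 0) :=
    (toV.hasFDerivAt.comp (0 : E 5)
      (((contDiff_cartanExp p.out).differentiable (by simp)) 0).hasFDerivAt).fderiv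
  rw [dCartan, hV, h3]
  exact hasFDerivAt_cartanExp_zero _ v

lemma SU3.transpose_mul_conj (u : SU3) : (u : Mat)ᵀ * ((u : Mat)ᵀ)ᴴ = 1 := by
  have := congrArg Matrix.transpose (SU3.conjTranspose_mul u)
  rw [Matrix.transpose_mul, Matrix.transpose_one] at this
  exact this

lemma sandwich_injective (u : SU3) {X Y : Mat}
    (h : (u : Mat) * X * (u : Mat)ᵀ = (u : Mat) * Y * (u : Mat)ᵀ) : X = Y := by
  have := congrArg (fun A => (u : Mat)ᴴ * A * ((u : Mat)ᵀ)ᴴ) h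
  simpa only [Matrix.mul_assoc, SU3.transpose_mul_conj, Matrix.mul_one, ← Matrix.mul_assoc (u : Mat)ᴴ,
    SU3.conjTranspose_mul, Matrix.one_mul] using this

lemma dCartan_injective (p : WuManifold) : Function.Injective (dCartan p) := by
  intro v w h
  rw [dCartan_apply, dCartan_apply] at h
  have h1 := smul_right_injective Mat (two_ne_zero (α := ℝ)) (sandwich_injective _ h)
  exact sym_injective (Subtype.ext h1)

/-- A chart is a smooth function (logarithm, then coordinates) of the Cartan image, so smoothness of
a continuous curve can be tested on matrices. -/
lemma contMDiffAt_of_cartan {f : ℝ → WuManifold} {t : ℝ} (hf : ContinuousAt f t)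
    (h : ContDiffAt ℝ ∞ (fun s => cartan (f s)) t) : ContMDiffAt 𝓘(ℝ, ℝ) (𝓡 5) ∞ f t := by
  rw [contMDiffAt_iff_target]
  refine ⟨hf, ContDiffAt.contMDiffAt ?_⟩
  set v : SU3 := (f t).out
  have hs : pull v (f t) ∈ logMat.target := mem_chart_source (E 5) (f t)
  have h1 : ContDiffAt ℝ ∞ (fun s => pull v (f s)) t := by
    unfold pull
    exact (contDiffAt_const.mul h).mul contDiffAt_const
  have h2 : ContDiffAt ℝ ∞ logMat.symm (pull v (f t)) :=
    (contDiffOn_logMat_symm.contDiffAt (logMat.open_target.mem_nhds hs)).of_le le_top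
  exact (contDiff_coord.of_le le_top).contDiffAt.comp t
    (ContDiffAt.const_smul (2 : ℝ)⁻¹ (h2.comp t h1))

lemma cartan_curve (u : SU3) (X : su3) (t : ℝ) : cartan (proj (u * expSU (t • X))) =
    (u : Mat) * (NormedSpace.exp (t • (X : Mat)) * NormedSpace.exp (t • (X : Mat)ᵀ)) * (u : Mat)ᵀ := by
  rw [cartan_proj]
  change ((u : Mat) * NormedSpace.exp (t • (X : Mat))) * ((u : Mat) * NormedSpace.exp (t • (X : Mat)))ᵀ = _
  rw [Matrix.transpose_mul, ← Matrix.exp_transpose, Matrix.transpose_smul]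
  simp only [Matrix.mul_assoc]

lemma contMDiffAt_proj_curve (u : SU3) (X : su3) :
    ContMDiffAt 𝓘(ℝ, ℝ) (𝓡 5) ∞ (fun t : ℝ => proj (u * expSU (t • X))) 0 := by
  have hc : Continuous fun t : ℝ => expSU (t • X) := by
    refine Continuous.subtype_mk ?_ _
    exact continuous_exp.comp (continuous_id.smul continuous_const)
  refine contMDiffAt_of_cartan ?_ ?_
  · have h2 : Continuous proj := continuous_quotient_mk'
    have h3 : Continuous fun v : SU3 => u * v :=
      (Continuous.matrix_mul continuous_const continuous_subtype_val).subtype_mk _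
    exact (h2.comp (h3.comp hc)).continuousAt
  · simp_rw [cartan_curve]
    have he : ∀ A : Mat, ContDiff ℝ ω fun t : ℝ => NormedSpace.exp (t • A) := fun A =>
      exp_contDiff.comp (contDiff_id.smul contDiff_const)
    exact (((contDiff_const.mul ((he _).mul (he _))).mul contDiff_const).of_le le_top).contDiffAt

/-- Product rule for `u exp(tX) exp(tXᵀ) uᵀ` at `t = 0`. Only the symmetric part of `X` survives,
which is the infinitesimal form of dividing by SO(3). -/
lemma dCartan_projDeriv (u : SU3) (X : su3) :
    dCartan (proj u) (projDeriv u X) = (u : Mat) * ((X : Mat) + (X : Mat)ᵀ) * (u : Mat)ᵀ := by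
  have hf := contMDiffAt_proj_curve u X
  unfold projDeriv
  set f : ℝ → WuManifold := fun t => proj (u * expSU (t • X)) with hfd
  have hf0 : f 0 = proj u := by
    have : expSU ((0 : ℝ) • X) = 1 := by
      apply Subtype.ext
      change NormedSpace.exp (((0 : ℝ) • X : su3) : Mat) = 1
      simp
    rw [hfd]
    simp only [this, mul_one]
  -- The points `f 0` and `proj u` are equal but not definitionally so; a variable base point lets
  -- the chain rule be applied at `f 0` and the result transported.
  have key : ∀ q, q = f 0 → dCartan q (mfderiv 𝓘(ℝ, ℝ) (𝓡 5) f 0 (1 : ℝ)) =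
      (u : Mat) * ((X : Mat) + (X : Mat)ᵀ) * (u : Mat)ᵀ := by
    rintro q rfl
    have h1 := mfderiv_comp (0 : ℝ) ((contMDiff_cartanV (f 0)).mdifferentiableAt (by simp))
      (hf.mdifferentiableAt (by simp))
    have h2 : mfderiv 𝓘(ℝ, ℝ) 𝓘(ℝ, V) (cartanV ∘ f) 0 (1 : ℝ) =
      toV ((u : Mat) * ((X : Mat) + (X : Mat)ᵀ) * (u : Mat)ᵀ) := by
      rw [mfderiv_eq_fderiv]
      have h3 : cartanV ∘ f = _ := funext fun t => congrArg toV (cartan_curve u X t)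
      rw [h3]
      have he : ∀ A : Mat, HasDerivAt (fun t : ℝ => NormedSpace.exp (t • A)) A 0 := fun A => by
        have := hasDerivAt_exp_smul_const (𝕂 := ℝ) A (0 : ℝ)
        rw [zero_smul, NormedSpace.exp_zero, one_mul] at this
        exact this
      have h4 := ((((he (X : Mat)).mul (he (X : Mat)ᵀ)).const_mul (u : Mat)).mul_const (u : Mat)ᵀ)
      have h5 := (toV.hasFDerivAt.comp_hasDerivAt (0 : ℝ) h4).deriv
      rw [← fderiv_apply_one_eq_deriv] at h5
      refine h5.trans ?_
      congr 1
      simp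
    rw [h1] at h2
    exact congrArg ofV h2
  exact key _ hf0.symm

end Analysis

/-! ### The symmetric space metric: construction, smoothness, uniqueness -/

section Metric

attribute [local instance] Matrix.linftyOpNormedRing Matrix.linftyOpNormedAlgebra

/-- The conjugate transpose, as a real continuous linear map. -/
def starV : V →L[ℝ] Mat :=
  LinearMap.toContinuousLinearMap
    { toFun := fun A => (Matrix.of A)ᴴ
      map_add' := fun A A' => by rw [← Matrix.conjTranspose_add]; rfl
      map_smul' := fun c A => by ext i j; simp [Matrix.conjTranspose_apply] }

/-- The real part of the trace. -/
def reTrace : Mat →L[ℝ] ℝ :=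
  LinearMap.toContinuousLinearMap
    { toFun := fun A => A.trace.re
      map_add' := fun A A' => by rw [Matrix.trace_add, Complex.add_re]
      map_smul' := fun c A => by rw [Matrix.trace_smul]; simp }

lemma reTrace_apply (A : Mat) : reTrace A = A.trace.re := rfl

/-- The trace form of the right logarithmic derivatives `D v * A⁻¹` and `D w * A⁻¹` of a unitary
matrix `A`. -/
def pullForm (c : ℝ) (A : V) (D : E 5 →L[ℝ] V) : E 5 →L[ℝ] E 5 →L[ℝ] ℝ :=
  (LinearMap.mk₂ ℝ (fun v w => -(c / 8) *
      reTrace (ofV (D v) * starV A * (ofV (D w) * starV A)))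
    (fun v v' w => by simp only [map_add, add_mul]; ring)
    (fun r v w => by simp only [map_smul, smul_mul_assoc, smul_eq_mul]; ring)
    (fun v w w' => by simp only [map_add, add_mul, mul_add])
    (fun r v w => by
      simp only [map_smul, smul_mul_assoc, mul_smul_comm, smul_eq_mul]; ring)).toContinuousBilinearMap

lemma pullForm_apply (c : ℝ) (A : V) (D : E 5 →L[ℝ] V) (v w : E 5) :
    pullForm c A D v w =
      -(c / 8) * reTrace (ofV (D v) * starV A * (ofV (D w) * starV A)) := rfl

lemma contDiff_pullForm (c : ℝ) :
    ContDiff ℝ ∞ (fun x : V × (E 5 →L[ℝ] V) => pullForm c x.1 x.2) := by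
  rw [contDiff_clm_apply_iff]
  intro v
  rw [contDiff_clm_apply_iff]
  intro w
  simp only [pullForm_apply]
  have h1 : ContDiff ℝ ∞ (fun x : V × (E 5 →L[ℝ] V) => starV x.1) :=
    starV.contDiff.comp contDiff_fst
  have h2 : ∀ v, ContDiff ℝ ∞ (fun x : V × (E 5 →L[ℝ] V) => ofV (x.2 v)) := fun v =>
    ofV.contDiff.comp (contDiff_snd.clm_apply contDiff_const)
  exact contDiff_const.mul (reTrace.contDiff.comp (((h2 v).mul h1).mul ((h2 w).mul h1)))

/-- The bilinear form of the symmetric space metric at a point. -/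
def metricForm (c : ℝ) (p : WuManifold) : E 5 →L[ℝ] E 5 →L[ℝ] ℝ :=
  pullForm c (cartanV p) (dCartanV p)

lemma metricForm_apply (c : ℝ) (p : WuManifold) (v w : E 5) : metricForm c p v w =
    -(c / 8) * (dCartan p v * (cartan p)ᴴ * (dCartan p w * (cartan p)ᴴ)).trace.re := rfl

lemma exists_proj (p : WuManifold) : ∃ u, proj u = p := ⟨_, proj_out p⟩

/-- The right logarithmic derivative at `u uᵀ` of the variation `u X uᵀ` is the conjugate of `X` by
`u`; traces of products of such conjugates no longer see `u`. -/
lemma mul_conj_cancel (u : SU3) (X : Mat) :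
    (u : Mat) * X * (u : Mat)ᵀ * ((u : Mat) * (u : Mat)ᵀ)ᴴ = (u : Mat) * X * (u : Mat)ᴴ := by
  rw [Matrix.conjTranspose_mul]
  simp only [Matrix.mul_assoc]
  rw [← Matrix.mul_assoc (u : Mat)ᵀ, SU3.transpose_mul_conj, Matrix.one_mul]

lemma trace_conj (u : SU3) (X Y : Mat) :
    ((u : Mat) * X * (u : Mat)ᴴ * ((u : Mat) * Y * (u : Mat)ᴴ)).trace = (X * Y).trace := by
  have : (u : Mat) * X * (u : Mat)ᴴ * ((u : Mat) * Y * (u : Mat)ᴴ) =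
      (u : Mat) * (X * Y * (u : Mat)ᴴ) := by
    simp only [Matrix.mul_assoc]
    rw [← Matrix.mul_assoc (u : Mat)ᴴ, SU3.conjTranspose_mul, Matrix.one_mul]
  rw [this, Matrix.trace_mul_comm, Matrix.mul_assoc, SU3.conjTranspose_mul, Matrix.mul_one]

/-- `projDeriv`, read in the preferred chart. -/
def velocity (u : SU3) (X : su3) : E 5 := projDeriv u X

lemma dCartan_velocity (u : SU3) (X : su3) :
    dCartan (proj u) (velocity u X) = (u : Mat) * ((X : Mat) + (X : Mat)ᵀ) * (u : Mat)ᵀ :=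
  dCartan_projDeriv u X

/-- For symmetric `X` one has `X + Xᵀ = 2X`, and the two factors 2 turn `c/8` into `c/2`. -/
lemma metricForm_velocity (c : ℝ) (u : SU3) (X Y : su3) (hX : (X : Mat)ᵀ = X)
    (hY : (Y : Mat)ᵀ = Y) : metricForm c (proj u) (velocity u X) (velocity u Y) =
      -(c / 2) * ((X : Mat) * (Y : Mat)).trace.re := by
  rw [metricForm_apply, dCartan_velocity, dCartan_velocity, cartan_proj, mul_conj_cancel,
    mul_conj_cancel, trace_conj, hX, hY, ← two_smul ℝ (X : Mat), ← two_smul ℝ (Y : Mat),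
    smul_mul_smul_comm, Matrix.trace_smul, Complex.smul_re, smul_eq_mul]
  ring

lemma metricForm_sym (c : ℝ) (p : WuManifold) (v w : E 5) : metricForm c p v w =
    -(c / 2) * ((sym v : Mat) * (sym w : Mat)).trace.re := by
  have h : cartan p = (p.out : Mat) * (p.out : Mat)ᵀ := by
    conv_lhs => rw [← proj_out p]
    exact cartan_proj _
  rw [metricForm_apply, dCartan_apply, dCartan_apply, h, mul_conj_cancel, mul_conj_cancel,
    trace_conj, smul_mul_smul_comm, Matrix.trace_smul, Complex.smul_re, smul_eq_mul, symL_apply,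
    symL_apply]
  ring

lemma SO3_transpose {k : SU3} (hk : k ∈ SO3) : (k : Mat)ᵀ = (k : Mat)ᴴ := by
  obtain ⟨r, -, hr⟩ := hk
  rw [hr]
  ext i j
  simp [Matrix.conjTranspose_apply]

/-- Surjectivity of `dπ_u`, already on symmetric elements. -/
lemma exists_horizontal (u : SU3) (v : E 5) :
    ∃ X : su3, (X : Mat)ᵀ = X ∧ velocity u X = v := by
  -- The chart is built from the chosen representative of the coset, not from `u`. The two differ by
  -- `k ∈ SO(3)`, and conjugation by a real orthogonal matrix preserves symmetry.
  set k : SU3 := u⁻¹ * (proj u).out with hkd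
  have hk : k ∈ SO3 := QuotientGroup.eq.1 (proj_out (proj u)).symm
  have hkt := SO3_transpose hk
  have hkt' : ((k : Mat)ᴴ)ᵀ = (k : Mat) := by rw [← hkt, Matrix.transpose_transpose]
  have hout : ((proj u).out : Mat) = (u : Mat) * (k : Mat) := by
    have : (proj u).out = u * k := by rw [hkd, mul_inv_cancel_left]
    rw [this]; rfl
  refine ⟨Ad k (sym v), ?_, ?_⟩
  · rw [Ad_coe, Matrix.transpose_mul, Matrix.transpose_mul, hkt', sym_transpose, hkt,
      Matrix.mul_assoc]
  · apply dCartan_injective (proj u)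
    rw [dCartan_velocity, dCartan_apply, hout, Ad_coe, Matrix.transpose_mul, Matrix.transpose_mul,
      Matrix.transpose_mul, hkt', sym_transpose, hkt, symL_apply, two_smul]
    noncomm_ring

lemma velocity_eq_zero_iff (u : SU3) (Z : su3) : velocity u Z = 0 ↔ (Z : Mat)ᵀ = -Z := by
  have h0 : dCartan (proj u) 0 = (u : Mat) * 0 * (u : Mat)ᵀ := by simp
  rw [← (dCartan_injective (proj u)).eq_iff, eq_neg_iff_add_eq_zero, add_comm]
  refine ⟨fun h => sandwich_injective u ?_, fun h => ?_⟩
  · rw [← dCartan_velocity, ← h0]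
    exact h
  · rw [dCartan_velocity, h]
    exact h0.symm

lemma trace_symm_skew {X Z : Mat} (hX : Xᵀ = X) (hZ : Zᵀ = -Z) : (Z * X).trace = 0 := by
  have h : (Z * X).trace = -(Z * X).trace := by
    conv_lhs => rw [← Matrix.trace_transpose, Matrix.transpose_mul, hX, hZ, Matrix.mul_neg,
      Matrix.trace_neg, Matrix.trace_mul_comm]
  exact self_eq_neg.1 h

lemma isHorizontal_iff {B : LinearMap.BilinForm ℝ su3} (hB : IsBiInvariant B) (u : SU3) (X : su3) :
    IsHorizontal B u X ↔ (X : Mat)ᵀ = X := by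
  obtain ⟨c, hc, hBc⟩ := hB.exists_trace
  constructor
  · intro h
    have hm : (X : Mat) - (X : Mat)ᵀ ∈ su3 := by
      have h1 : (X : Mat)ᴴ = -X := X.2.1
      have h2 : (X : Mat).trace = 0 := X.2.2
      refine ⟨?_, ?_⟩
      · rw [Matrix.conjTranspose_sub, h1]
        have : ((X : Mat)ᵀ)ᴴ = ((X : Mat)ᴴ)ᵀ := rfl
        rw [this, h1, Matrix.transpose_neg]
        abel
      · rw [Matrix.trace_sub, Matrix.trace_transpose, sub_self]
    -- The skew part of `X`, up to a factor, is vertical. As `Z = 2X - (X + Xᵀ)` and symmetric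
    -- matrices are trace-orthogonal to skew ones, `B Z Z = 2 * B Z X = 0`.
    set Z : su3 := ⟨_, hm⟩ with hZ
    have hZc : (Z : Mat) = (X : Mat) - (X : Mat)ᵀ := rfl
    have hZt : (Z : Mat)ᵀ = -Z := by
      rw [hZc, Matrix.transpose_sub, Matrix.transpose_transpose, neg_sub]
    have h1 := h Z ((velocity_eq_zero_iff u Z).2 hZt)
    have h2 : B Z Z = 2 * B Z X := by
      have h3 : ((Z : Mat) * ((X : Mat) + (X : Mat)ᵀ)).trace = 0 := trace_symm_skew
        (by rw [Matrix.transpose_add, Matrix.transpose_transpose, add_comm]) hZt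
      have h4 : (Z : Mat) * (Z : Mat) =
          (2 : ℝ) • ((Z : Mat) * (X : Mat)) - (Z : Mat) * ((X : Mat) + (X : Mat)ᵀ) := by
        conv_lhs => rw [hZc]
        rw [hZc, two_smul]
        noncomm_ring
      rw [hBc, hBc, h4, Matrix.trace_sub, h3, sub_zero, Matrix.trace_smul, Complex.smul_re,
        smul_eq_mul]
      ring
    have h3 : Z = 0 := by
      by_contra hne
      have := hB.pos Z hne
      rw [h2, h1] at this
      simp at this
    have h4 : (X : Mat) - (X : Mat)ᵀ = 0 := congrArg Subtype.val h3
    exact (sub_eq_zero.1 h4).symm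
  · intro hX Z hZ
    rw [hBc, trace_symm_skew hX ((velocity_eq_zero_iff u Z).1 hZ)]
    simp

lemma trace_sym_mul (x y : E 5) : ((sym x : Mat) * (sym y : Mat)).trace.re = -(2 * (x 0 * y 0
    + x 1 * y 1 + x 2 * y 2 + x 3 * y 3 + x 4 * y 4) + x 0 * y 1 + x 1 * y 0) := by
  rw [Matrix.trace_fin_three]
  simp only [Matrix.mul_apply, Fin.sum_univ_three, sym, LinearMap.coe_mk, AddHom.coe_mk]
  simp
  ring

lemma metricForm_coord (c : ℝ) (p : WuManifold) (x y : E 5) : metricForm c p x y =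
    c * (x 0 * y 0 + x 1 * y 1 + x 2 * y 2 + x 3 * y 3 + x 4 * y 4
      + (x 0 * y 1 + x 1 * y 0) / 2) := by
  rw [metricForm_sym, trace_sym_mul]
  ring

/-- The cross term is absorbed by `x₀² + x₁² + x₀x₁ - (x₀² + x₁²)/2 = (x₀ + x₁)²/2`. -/
lemma norm_sq_le_metricForm {c : ℝ} (hc : 0 < c) (p : WuManifold) (x : E 5) :
    c / 2 * ‖x‖ ^ 2 ≤ metricForm c p x x := by
  rw [metricForm_coord, EuclideanSpace.norm_sq_eq, Fin.sum_univ_five]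
  simp only [Real.norm_eq_abs, sq_abs]
  have : c * (x 0 * x 0 + x 1 * x 1 + x 2 * x 2 + x 3 * x 3 + x 4 * x 4
      + (x 0 * x 1 + x 1 * x 0) / 2) - c / 2 * (x 0 ^ 2 + x 1 ^ 2 + x 2 ^ 2 + x 3 ^ 2 + x 4 ^ 2)
      = c / 2 * ((x 0 + x 1) ^ 2 + x 2 ^ 2 + x 3 ^ 2 + x 4 ^ 2) := by ring
  have : 0 ≤ c / 2 * ((x 0 + x 1) ^ 2 + x 2 ^ 2 + x 3 ^ 2 + x 4 ^ 2) := by positivity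
  linarith

lemma isVonNBounded_metricForm {c : ℝ} (hc : 0 < c) (p : WuManifold) :
    Bornology.IsVonNBounded ℝ {v : E 5 | metricForm c p v v < 1} := by
  rw [NormedSpace.isVonNBounded_iff, isBounded_iff_forall_norm_le]
  -- The added 1 avoids a square root: beyond this radius `‖v‖ > 1`, so `‖v‖² > ‖v‖ > 2/c`.
  refine ⟨2 / c + 1, fun v hv => ?_⟩
  have h1 := norm_sq_le_metricForm hc p v
  have h2 : metricForm c p v v < 1 := hv
  by_contra! h
  have h3 : ‖v‖ ^ 2 < 2 / c := by
    rw [lt_div_iff₀ hc]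
    linarith
  have h4 : 0 < 2 / c := by positivity
  nlinarith

end Metric

open Bundle

/-- The symmetric space metric on the tangent spaces. -/
def metricInner (c : ℝ) (p : WuManifold) :
    TangentSpace (𝓡 5) p →L[ℝ] TangentSpace (𝓡 5) p →L[ℝ] ℝ := metricForm c p

/-- In the tangent trivialization at `p`, the metric is the smooth map `pullForm` applied to the
Cartan embedding and its differential in tangent coordinates, both of which are smooth. -/
lemma contMDiff_metricInner (c : ℝ) : ContMDiff (𝓡 5) ((𝓡 5).prod 𝓘(ℝ, E 5 →L[ℝ] E 5 →L[ℝ] ℝ)) ∞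
    (fun p : WuManifold => TotalSpace.mk' (E 5 →L[ℝ] E 5 →L[ℝ] ℝ)
      (E := fun p : WuManifold => TangentSpace (𝓡 5) p →L[ℝ] TangentSpace (𝓡 5) p →L[ℝ] ℝ)
      p (metricInner c p)) := by
  intro p
  rw [contMDiffAt_section]
  have h1 : ContMDiffAt (𝓡 5) 𝓘(ℝ, E 5 →L[ℝ] V) ∞
      (inTangentCoordinates (𝓡 5) 𝓘(ℝ, V) id cartanV (mfderiv (𝓡 5) 𝓘(ℝ, V) cartanV) p) p :=
    (contMDiff_cartanV p).mfderiv_const (by simp)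
  have h2 := (contDiff_pullForm c).contMDiff.contMDiffAt.comp p
    ((contMDiff_cartanV p).prodMk_space h1)
  refine h2.congr_of_eventuallyEq ?_
  filter_upwards [(chartAt (E 5) p).open_source.mem_nhds (mem_chart_source (E 5) p)] with q hq
  have hb : q ∈ (trivializationAt (E 5) (TangentSpace (𝓡 5)) p).baseSet := hq
  ext v w
  rw [hom_trivializationAt_apply]
  refine (inCoordinates_apply_eq₂ hb hb (by simp)).trans ?_
  have key : ∀ v : E 5, inTangentCoordinates (𝓡 5) 𝓘(ℝ, V) id cartanV
      (mfderiv (𝓡 5) 𝓘(ℝ, V) cartanV) p q v =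
      dCartanV q ((trivializationAt (E 5) (TangentSpace (𝓡 5)) p).symm q v) := by
    intro v
    change ((trivializationAt V (TangentSpace 𝓘(ℝ, V)) (cartanV p)).continuousLinearMapAt ℝ
      (cartanV q)) (dCartanV q ((trivializationAt (E 5) (TangentSpace (𝓡 5)) p).symmL ℝ q v)) = _
    rw [TangentBundle.continuousLinearMapAt_model_space, Trivialization.symmL_apply _ hb]
    rfl
  simp only [Function.comp_apply, pullForm_apply, key]
  simp only [Bundle.Trivial.fiberBundle_trivializationAt', Trivial.linearMapAt_trivialization,
    LinearMap.id_coe, id_eq]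
  rfl

lemma metricForm_symm (c : ℝ) (p : WuManifold) (v w : E 5) :
    metricForm c p v w = metricForm c p w v := by
  rw [metricForm_coord, metricForm_coord]
  ring

lemma metricForm_pos {c : ℝ} (hc : 0 < c) (p : WuManifold) (v : E 5) (hv : v ≠ 0) :
    0 < metricForm c p v v := by
  refine lt_of_lt_of_le ?_ (norm_sq_le_metricForm hc p v)
  have := norm_pos_iff.2 hv
  positivity

/-- The symmetric space metric on `SU(3)/SO(3)`. -/
def symmetricMetric (c : ℝ) (hc : 0 < c) : Riem.Metric 5 WuManifold where
  inner p := metricInner c p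
  symm p v w := metricForm_symm c p v w
  pos p v hv := metricForm_pos hc p v hv
  isVonNBounded p := isVonNBounded_metricForm hc p
  contMDiff := contMDiff_metricInner c

lemma isSymmetricSpaceMetric_symmetricMetric {B : LinearMap.BilinForm ℝ su3}
    (hB : IsBiInvariant B) {c : ℝ} (hc : 0 < c)
    (hBc : ∀ X Y : su3, B X Y = -(c / 2) * ((X : Mat) * (Y : Mat)).trace.re) :
    IsSymmetricSpaceMetric B (symmetricMetric c hc) where
  surjective u v := by
    obtain ⟨X, -, hX⟩ := exists_horizontal u v
    exact ⟨X, hX⟩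
  isometry u X Y hX hY := by
    rw [hBc]
    exact metricForm_velocity c u X Y ((isHorizontal_iff hB u X).1 hX)
      ((isHorizontal_iff hB u Y).1 hY)

/-- Every pair of tangent vectors is the image of a horizontal pair, on which the isometry condition
leaves no choice. -/
lemma IsSymmetricSpaceMetric.eq {B : LinearMap.BilinForm ℝ su3} (hB : IsBiInvariant B)
    {g g' : Riem.Metric 5 WuManifold} (hg : IsSymmetricSpaceMetric B g)
    (hg' : IsSymmetricSpaceMetric B g') : g' = g := by
  have h : g'.inner = g.inner := by
    funext p
    obtain ⟨u, rfl⟩ := exists_proj p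
    ext v w
    obtain ⟨X, hX, hXv⟩ := exists_horizontal u v
    obtain ⟨Y, hY, hYw⟩ := exists_horizontal u w
    have e1 := hg.isometry u X Y ((isHorizontal_iff hB u X).2 hX) ((isHorizontal_iff hB u Y).2 hY)
    have e2 := hg'.isometry u X Y ((isHorizontal_iff hB u X).2 hX) ((isHorizontal_iff hB u Y).2 hY)
    have hv : projDeriv u X = v := hXv
    have hw : projDeriv u Y = w := hYw
    rw [hv, hw] at e1 e2
    rw [e1, e2]
  cases g
  cases g'
  congr

end

end Wu

/-! ### Curvature at a point where the first derivatives of the metric vanish -/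

namespace Riem

noncomputable section

/-- Since `h` is `O(x - x₀)` and `f - f x₀` is `o(1)`, the term `(f - f x₀) h` is `o(x - x₀)`.
Applied with `f` an entry of the inverse Gram matrix, this needs only its continuity. -/
lemma hasFDerivAt_mul_of_eq_zero {E : Type*} [NormedAddCommGroup E] [NormedSpace ℝ E]
    {f h : E → ℝ} {h' : E →L[ℝ] ℝ} {x₀ : E} (hf : ContinuousAt f x₀) (hh : HasFDerivAt h h' x₀)
    (h0 : h x₀ = 0) : HasFDerivAt (fun x => f x * h x) (f x₀ • h') x₀ := by
  have h1 : HasFDerivAt (fun x => f x₀ * h x) (f x₀ • h') x₀ := hh.const_mul (f x₀)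
  have h2 : HasFDerivAt (fun x => (f x - f x₀) * h x) (0 : E →L[ℝ] ℝ) x₀ := by
    rw [hasFDerivAt_iff_isLittleO]
    have a : (fun x => f x - f x₀) =o[𝓝 x₀] fun _ => (1 : ℝ) := by
      rw [Asymptotics.isLittleO_one_iff]
      have := hf.tendsto.sub_const (f x₀)
      rwa [sub_self] at this
    have b : h =O[𝓝 x₀] fun x => x - x₀ := by
      have := hh.isBigO_sub
      simpa [h0] using this
    have d := a.mul_isBigO b.norm_right
    simp only [one_mul] at d
    simpa [h0] using d.norm_right
  have h3 := h1.add h2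
  rw [add_zero] at h3
  refine h3.congr_of_eventuallyEq (Filter.Eventually.of_forall fun x => ?_)
  simp only [Pi.add_apply]
  ring

section

variable {n : ℕ}

/-- The Christoffel symbols of a matrix-valued function. -/
def chris (h : EuclideanSpace ℝ (Fin n) → Matrix (Fin n) (Fin n) ℝ) (k i j : Fin n)
    (x : EuclideanSpace ℝ (Fin n)) : ℝ :=
  (1 / 2) * ∑ l, (h x)⁻¹ k l *
    (pd i (fun y => h y j l) x + pd j (fun y => h y i l) x - pd l (fun y => h y i j) x)

lemma chris_eq_zero {h : EuclideanSpace ℝ (Fin n) → Matrix (Fin n) (Fin n) ℝ}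
    {x₀ : EuclideanSpace ℝ (Fin n)} (h1 : ∀ k i j, pd k (fun y => h y i j) x₀ = 0) (k i j : Fin n) :
    chris h k i j x₀ = 0 := by
  simp [chris, h1]

/-- The bracket of first derivatives vanishes at `x₀`, so only its own derivative contributes and
the inverse matrix is frozen at `x₀`. -/
lemma pd_chris {h : EuclideanSpace ℝ (Fin n) → Matrix (Fin n) (Fin n) ℝ}
    {x₀ : EuclideanSpace ℝ (Fin n)} (hs : ∀ i j, ContDiff ℝ ∞ fun y => h y i j)
    (hdet : IsUnit (h x₀).det) (h1 : ∀ k i j, pd k (fun y => h y i j) x₀ = 0) (a k i j : Fin n) :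
    pd a (chris h k i j) x₀ = (1 / 2) * ∑ l, (h x₀)⁻¹ k l *
      (pd a (pd i fun y => h y j l) x₀ + pd a (pd j fun y => h y i l) x₀
        - pd a (pd l fun y => h y i j) x₀) := by
  have hpd : ∀ k i j, DifferentiableAt ℝ (pd k fun y => h y i j) x₀ := by
    intro k i j
    have : ContDiff ℝ ∞ (pd k fun y => h y i j) :=
      ((hs i j).fderiv_right (m := ∞) (by simp)).clm_apply contDiff_const
    exact (this.differentiable (by simp)) x₀
  have hcont : Continuous h := continuous_matrix fun i j => (hs i j).continuous
  have hinv : ∀ k l, ContinuousAt (fun x => (h x)⁻¹ k l) x₀ := by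
    intro k l
    have hi : ContinuousAt (fun x => (h x)⁻¹) x₀ := by
      simp only [Matrix.inv_def]
      refine ContinuousAt.smul (f := fun x => Ring.inverse (h x).det)
        (g := fun x => (h x).adjugate) ?_ hcont.matrix_adjugate.continuousAt
      have : (fun x => Ring.inverse (h x).det) = fun x => ((h x).det)⁻¹ := by
        funext x; exact Ring.inverse_eq_inv _
      rw [this]
      exact hcont.matrix_det.continuousAt.inv₀ hdet.ne_zero
    exact (continuous_apply_apply k l).continuousAt.comp hi
  have key : HasFDerivAt (chris h k i j) ((1 / 2 : ℝ) • ∑ l, (h x₀)⁻¹ k l •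
      (fderiv ℝ (pd i fun y => h y j l) x₀ + fderiv ℝ (pd j fun y => h y i l) x₀
        - fderiv ℝ (pd l fun y => h y i j) x₀)) x₀ := by
    have : chris h k i j = fun x => (1 / 2 : ℝ) * ∑ l, (h x)⁻¹ k l *
      (pd i (fun y => h y j l) x + pd j (fun y => h y i l) x - pd l (fun y => h y i j) x) := rfl
    rw [this]
    refine HasFDerivAt.const_mul (HasFDerivAt.fun_sum fun l _ => ?_) _
    refine hasFDerivAt_mul_of_eq_zero (hinv k l) ?_ (by simp [h1])
    exact ((hpd _ _ _).hasFDerivAt.add (hpd _ _ _).hasFDerivAt).sub (hpd _ _ _).hasFDerivAt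
  rw [pd, key.fderiv]
  simp [pd]

variable {M : Type*} [TopologicalSpace M] [ChartedSpace (EuclideanSpace ℝ (Fin n)) M]
  [IsManifold (𝓡 n) ∞ M]

lemma christoffel_eventuallyEq {g : Metric n M} {p : M}
    {h : EuclideanSpace ℝ (Fin n) → Matrix (Fin n) (Fin n) ℝ} {x₀ : EuclideanSpace ℝ (Fin n)}
    (hg : gram g p =ᶠ[𝓝 x₀] h) (k i j : Fin n) : christoffel g p k i j =ᶠ[𝓝 x₀] chris h k i j := by
  filter_upwards [hg.eventually_nhds] with x hx
  have hpd : ∀ k i j, pd k (fun y => gram g p y i j) x = pd k (fun y => h y i j) x := by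
    intro k i j
    have : (fun y => gram g p y i j) =ᶠ[𝓝 x] fun y => h y i j := hx.mono fun y hy =>
      congrFun (congrFun hy i) j
    rw [pd, pd, this.fderiv_eq]
  simp only [christoffel, chris, hpd, hx.self_of_nhds]

/-- The curvature tensor at a point where the first derivatives of the metric vanish. -/
lemma curvatureCoeff_of_gram {g : Metric n M} {p : M}
    {h : EuclideanSpace ℝ (Fin n) → Matrix (Fin n) (Fin n) ℝ} {x₀ : EuclideanSpace ℝ (Fin n)}
    (hg : gram g p =ᶠ[𝓝 x₀] h) (hs : ∀ i j, ContDiff ℝ ∞ fun y => h y i j)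
    (hdet : IsUnit (h x₀).det) (h1 : ∀ k i j, pd k (fun y => h y i j) x₀ = 0)
    {H : Fin n → Fin n → Fin n → Fin n → ℝ} (hH : ∀ a b i j, pd a (pd b fun y => h y i j) x₀ = H a b i j)
    (hHs : ∀ a b i j, H a b i j = H b a i j)
    (l i j k : Fin n) :
    curvatureCoeff g p l i j k x₀ = ∑ m, (h x₀)⁻¹ l m *
      ((1 / 2) * (H i k j m - H i m j k - H j k i m + H j m i k)) := by
  have e : ∀ a k i j, pd a (christoffel g p k i j) x₀ = pd a (chris h k i j) x₀ := fun a k i j => by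
    rw [pd, pd, (christoffel_eventuallyEq hg k i j).fderiv_eq]
  have z : ∀ k i j, christoffel g p k i j x₀ = 0 := fun k i j => by
    rw [(christoffel_eventuallyEq hg k i j).eq_of_nhds, chris_eq_zero h1]
  simp only [curvatureCoeff, e, z, pd_chris hs hdet h1, hH, mul_zero, sub_zero,
    Finset.sum_const_zero, add_zero]
  rw [Finset.mul_sum, Finset.mul_sum, ← Finset.sum_sub_distrib]
  refine Finset.sum_congr rfl fun m _ => ?_
  -- The terms `∂ᵢ∂ⱼ gₖₘ` and `∂ⱼ∂ᵢ gₖₘ` cancel.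
  rw [hHs j i]
  ring

/-- Lowering the index multiplies by the Gram matrix and cancels the inverse in the Christoffel
symbols, so the inverse never has to be computed. -/
lemma inner_curvature_of_gram {g : Metric n M} {p : M}
    {h : EuclideanSpace ℝ (Fin n) → Matrix (Fin n) (Fin n) ℝ}
    (hg : gram g p =ᶠ[𝓝 (chartAt (EuclideanSpace ℝ (Fin n)) p p)] h)
    (hs : ∀ i j, ContDiff ℝ ∞ fun y => h y i j)
    (hdet : IsUnit (h (chartAt (EuclideanSpace ℝ (Fin n)) p p)).det)
    (h1 : ∀ k i j, pd k (fun y => h y i j) (chartAt (EuclideanSpace ℝ (Fin n)) p p) = 0)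
    {H : Fin n → Fin n → Fin n → Fin n → ℝ}
    (hH : ∀ a b i j, pd a (pd b fun y => h y i j) (chartAt (EuclideanSpace ℝ (Fin n)) p p) = H a b i j)
    (hHs : ∀ a b i j, H a b i j = H b a i j)
    (hin : ∀ v w : EuclideanSpace ℝ (Fin n), g.inner p v w =
      ∑ l, ∑ m, h (chartAt (EuclideanSpace ℝ (Fin n)) p p) m l * v l * w m)
    (X Y Z W : EuclideanSpace ℝ (Fin n)) :
    g.inner p (curvature g p X Y Z) W = ∑ i, ∑ j, ∑ k, ∑ m,
      (1 / 2) * (H i k j m - H i m j k - H j k i m + H j m i k) * X i * Y j * Z k * W m := by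
  set x₀ := chartAt (EuclideanSpace ℝ (Fin n)) p p
  set K : Fin n → Fin n → Fin n → Fin n → ℝ := fun i j k m =>
    (1 / 2) * (H i k j m - H i m j k - H j k i m + H j m i k) with hK
  set T : Fin n → ℝ := fun m => ∑ i, ∑ j, ∑ k, K i j k m * X i * Y j * Z k with hT
  have hc : ∀ l, ∑ i, ∑ j, ∑ k, curvatureCoeff g p l i j k x₀ * X i * Y j * Z k =
      ((h x₀)⁻¹ *ᵥ T) l := by
    intro l
    simp only [curvatureCoeff_of_gram hg hs hdet h1 hH hHs, Finset.sum_mul, Finset.mul_sum, hT,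
      Matrix.mulVec, dotProduct]
    symm
    rw [Finset.sum_comm]
    refine Finset.sum_congr rfl fun i _ => ?_
    rw [Finset.sum_comm]
    refine Finset.sum_congr rfl fun j _ => ?_
    rw [Finset.sum_comm]
    refine Finset.sum_congr rfl fun k _ => Finset.sum_congr rfl fun m _ => ?_
    rw [hK]
    ring
  refine (hin (WithLp.toLp 2 fun l => ∑ i, ∑ j, ∑ k,
    curvatureCoeff g p l i j k x₀ * X i * Y j * Z k) W).trans ?_
  simp only [hc]
  have h2 : h x₀ *ᵥ ((h x₀)⁻¹ *ᵥ T) = T := by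
    rw [Matrix.mulVec_mulVec, Matrix.mul_nonsing_inv _ hdet, Matrix.one_mulVec]
  rw [Finset.sum_comm]
  have h3 : ∀ m, ∑ l, h x₀ m l * ((h x₀)⁻¹ *ᵥ T) l * W m = T m * W m := by
    intro m
    rw [← Finset.sum_mul]
    congr 1
    exact congrFun h2 m
  simp only [h3]
  simp only [hT, Finset.sum_mul]
  rw [Finset.sum_comm]
  refine Finset.sum_congr rfl fun i _ => ?_
  rw [Finset.sum_comm]
  refine Finset.sum_congr rfl fun j _ => ?_
  rw [Finset.sum_comm]

end

end

end Riem

/-! ### Derivatives of the exponential at the origin, up to order three -/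

namespace Wu

noncomputable section

section Exp

variable {𝔸 : Type*} [NormedRing 𝔸] [NormedAlgebra ℝ 𝔸] [CompleteSpace 𝔸]

lemma contDiff_exp_algebra : ContDiff ℝ ∞ (NormedSpace.exp : 𝔸 → 𝔸) :=
  contDiff_iff_contDiffAt.2 fun x => (NormedSpace.exp_analytic (𝕂 := ℝ) x).contDiffAt

/-- The Taylor coefficients of the exponential series. -/
lemma iteratedFDeriv_exp_zero (n : ℕ) (v : Fin n → 𝔸) :
    iteratedFDeriv ℝ n (NormedSpace.exp : 𝔸 → 𝔸) 0 v =
      ∑ σ : Equiv.Perm (Fin n), (n.factorial : ℝ)⁻¹ • (List.ofFn fun i => v (σ i)).prod := by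
  rw [(NormedSpace.exp_hasFPowerSeriesOnBall (𝕂 := ℝ) (𝔸 := 𝔸)).iteratedFDeriv_eq_sum_of_completeSpace]
  rfl

variable {E : Type*} [NormedAddCommGroup E] [NormedSpace ℝ E]

/-- The derivative in the direction `v`. -/
def dirD {F : Type*} [NormedAddCommGroup F] [NormedSpace ℝ F] (v : E) (f : E → F) (x : E) : F :=
  fderiv ℝ f x v

lemma contDiff_dirD {F : Type*} [NormedAddCommGroup F] [NormedSpace ℝ F] {f : E → F}
    (hf : ContDiff ℝ ∞ f) (v : E) : ContDiff ℝ ∞ (dirD v f) :=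
  (hf.fderiv_right (m := ∞) (by simp)).clm_apply contDiff_const

lemma dirD_comp {F G : Type*} [NormedAddCommGroup F] [NormedSpace ℝ F] [NormedAddCommGroup G]
    [NormedSpace ℝ G] {f : F → G} (hf : ContDiff ℝ ∞ f) (L : E →L[ℝ] F) (v : E) :
    dirD v (fun x => f (L x)) = fun x => dirD (L v) f (L x) := by
  funext x
  have h := ((hf.differentiable (by simp)) (L x)).hasFDerivAt.comp x L.hasFDerivAt
  rw [dirD, dirD]
  have h' : HasFDerivAt (fun x => f (L x)) ((fderiv ℝ f (L x)).comp L) x := h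
  rw [h'.fderiv]
  rfl

lemma iteratedFDeriv_two_eq_dirD {F : Type*} [NormedAddCommGroup F] [NormedSpace ℝ F] {f : E → F}
    (hf : ContDiff ℝ ∞ f) (a b : E) (x : E) :
    iteratedFDeriv ℝ 2 f x ![a, b] = dirD a (dirD b f) x := by
  rw [iteratedFDeriv_two_apply]
  have h : DifferentiableAt ℝ (fderiv ℝ f) x :=
    ((hf.fderiv_right (m := ∞) (by simp)).differentiable (by simp)) x
  have h2 := h.hasFDerivAt.clm_apply (hasFDerivAt_const b x)
  have h3 : fderiv ℝ (dirD b f) x = _ := h2.fderiv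
  rw [dirD, h3]
  simp

lemma iteratedFDeriv_three_eq_dirD {F : Type*} [NormedAddCommGroup F] [NormedSpace ℝ F] {f : E → F}
    (hf : ContDiff ℝ ∞ f) (a b c : E) (x : E) :
    iteratedFDeriv ℝ 3 f x ![a, b, c] = dirD a (dirD b (dirD c f)) x := by
  rw [iteratedFDeriv_succ_apply_left]
  have h : DifferentiableAt ℝ (iteratedFDeriv ℝ 2 f) x :=
    hf.differentiable_iteratedFDeriv (WithTop.coe_lt_coe.2 (ENat.natCast_lt_top 2)) x
  have h2 := ((ContinuousMultilinearMap.apply ℝ (fun _ : Fin 2 => E) F ![b, c]).hasFDerivAt.comp x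
    h.hasFDerivAt)
  have h3 : (fun y => iteratedFDeriv ℝ 2 f y ![b, c]) = dirD b (dirD c f) :=
    funext fun y => iteratedFDeriv_two_eq_dirD hf b c y
  have h4 : HasFDerivAt (fun y => iteratedFDeriv ℝ 2 f y ![b, c]) _ x := h2
  rw [h3] at h4
  rw [dirD, h4.fderiv]
  rfl

lemma dirD_exp_zero (a : 𝔸) : dirD a (NormedSpace.exp : 𝔸 → 𝔸) 0 = a := by
  have := (hasFDerivAt_exp_zero (𝕂 := ℝ) (𝔸 := 𝔸)).fderiv
  rw [dirD, this]
  rfl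

lemma dirD_dirD_exp_zero (a b : 𝔸) : dirD a (dirD b (NormedSpace.exp : 𝔸 → 𝔸)) 0 =
    (1 / 2 : ℝ) • (a * b + b * a) := by
  rw [← iteratedFDeriv_two_eq_dirD contDiff_exp_algebra, iteratedFDeriv_exp_zero]
  rw [← Finset.smul_sum]
  have : (Finset.univ : Finset (Equiv.Perm (Fin 2))) = {1, Equiv.swap 0 1} := by decide
  rw [this, Finset.sum_pair (by decide)]
  simp [List.ofFn_succ]

lemma dirD_dirD_dirD_exp_zero (a b c : 𝔸) :
    dirD a (dirD b (dirD c (NormedSpace.exp : 𝔸 → 𝔸))) 0 =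
    (1 / 6 : ℝ) • (a * b * c + a * c * b + b * a * c + b * c * a + c * a * b + c * b * a) := by
  rw [← iteratedFDeriv_three_eq_dirD contDiff_exp_algebra, iteratedFDeriv_exp_zero]
  rw [← Finset.smul_sum]
  have : (Finset.univ : Finset (Equiv.Perm (Fin 3))) = {1, Equiv.swap 0 1, Equiv.swap 0 2,
    Equiv.swap 1 2, Equiv.swap 0 1 * Equiv.swap 1 2, Equiv.swap 1 2 * Equiv.swap 0 1} := by decide
  rw [this, Finset.sum_insert (by decide), Finset.sum_insert (by decide),
    Finset.sum_insert (by decide), Finset.sum_insert (by decide), Finset.sum_insert (by decide),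
    Finset.sum_singleton]
  have s1 : Equiv.swap (0 : Fin 3) 1 2 = 2 := by decide
  have s2 : Equiv.swap (0 : Fin 3) 2 1 = 1 := by decide
  have s3 : Equiv.swap (1 : Fin 3) 2 0 = 0 := by decide
  simp only [List.ofFn_succ, Fin.isValue, Equiv.Perm.coe_one, id_eq, Equiv.Perm.coe_mul,
    Function.comp_apply, List.ofFn_zero, List.prod_cons, List.prod_nil, mul_one, Fin.succ_zero_eq_one,
    Fin.succ_one_eq_two, Equiv.swap_apply_left, Equiv.swap_apply_right, s1, s2, s3,
    Matrix.cons_val]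
  norm_num [Nat.factorial]
  simp only [mul_assoc]
  abel

end Exp

/-! ### The trace form of `exp L` and `exp(-L)`, to second order -/

section Exp

variable {𝔸 : Type*} [NormedRing 𝔸] [NormedAlgebra ℝ 𝔸]
variable {E : Type*} [NormedAddCommGroup E] [NormedSpace ℝ E]

lemma dirD_mul {f g : E → 𝔸} (hf : ContDiff ℝ ∞ f) (hg : ContDiff ℝ ∞ g) (v : E) :
    dirD v (fun x => f x * g x) = fun x => dirD v f x * g x + f x * dirD v g x := by
  funext x
  have h := ((hf.differentiable (by simp)) x).hasFDerivAt.mul'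
    ((hg.differentiable (by simp)) x).hasFDerivAt
  have h' : HasFDerivAt (fun x => f x * g x) _ x := h
  rw [dirD, h'.fderiv]
  simp [dirD, add_comm]

lemma dirD_clm (τ : 𝔸 →L[ℝ] ℝ) {f : E → 𝔸} (hf : ContDiff ℝ ∞ f) (v : E) :
    dirD v (fun x => τ (f x)) = fun x => τ (dirD v f x) := by
  funext x
  have h := τ.hasFDerivAt.comp x ((hf.differentiable (by simp)) x).hasFDerivAt
  have h' : HasFDerivAt (fun x => τ (f x)) (τ.comp (fderiv ℝ f x)) x := h
  rw [dirD, h'.fderiv]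
  rfl

/-- Antisymmetrizing the second derivatives collapses the sum of commutator products to a single
one. It is an identity between words of length four modulo cyclic rotation. -/
lemma curvature_gramExp {τ : 𝔸 →L[ℝ] ℝ} {L : E →L[ℝ] 𝔸}
    (hτ : ∀ x y, τ (x * y) = τ (y * x)) (i j k m : E)
    {H : E → E → E → E → ℝ} (κ : ℝ)
    (hH : ∀ a b c d, H a b c d = κ * ((1 / 12) *
      (τ ((L a * L c - L c * L a) * (L b * L d - L d * L b))
      + τ ((L b * L c - L c * L b) * (L a * L d - L d * L a))))) :
    (1 / 2) * (H i k j m - H i m j k - H j k i m + H j m i k) =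
      κ / 4 * τ ((L i * L j - L j * L i) * (L k * L m - L m * L k)) := by
  simp only [hH]
  generalize L i = A, L j = B, L k = C, L m = D
  -- Normal form for cyclic words: each is rotated so that `A` comes first, after which the identity
  -- is linear.
  have h4 : ∀ x y z, τ (x * (y * (z * A))) = τ (A * (x * (y * z))) := fun x y z => by
    simpa only [mul_assoc] using hτ (x * (y * z)) A
  have h3 : ∀ x y z, τ (x * (y * (A * z))) = τ (A * (z * (x * y))) := fun x y z => by
    simpa only [mul_assoc] using hτ (x * y) (A * z)
  have h2 : ∀ x y z, τ (x * (A * (y * z))) = τ (A * (y * (z * x))) := fun x y z => by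
    simpa only [mul_assoc] using hτ x (A * (y * z))
  simp only [map_sub, sub_mul, mul_sub, mul_assoc, h4, h3, h2]
  ring

variable [CompleteSpace 𝔸]

/-- `x ↦ exp (L x)`. -/
def expL (L : E →L[ℝ] 𝔸) (x : E) : 𝔸 := NormedSpace.exp (L x)

lemma contDiff_expL (L : E →L[ℝ] 𝔸) : ContDiff ℝ ∞ (expL L) :=
  contDiff_exp_algebra.comp L.contDiff

lemma expL_neg_mul (L : E →L[ℝ] 𝔸) (x : E) : expL (-L) x * expL L x = 1 := by
  let _ : NormedAlgebra ℚ 𝔸 := NormedAlgebra.restrictScalars ℚ ℝ 𝔸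
  rw [expL, expL, ← NormedSpace.exp_add_of_commute]
  · simp
  · simp [Commute, SemiconjBy]

lemma expL_mul_neg (L : E →L[ℝ] 𝔸) (x : E) : expL L x * expL (-L) x = 1 := by
  simpa using expL_neg_mul (-L) x

lemma dirD_expL_zero (L : E →L[ℝ] 𝔸) (a : E) : dirD a (expL L) 0 = L a := by
  have h : expL L = fun x => NormedSpace.exp (L x) := rfl
  rw [h, dirD_comp contDiff_exp_algebra]
  simp only [map_zero]
  exact dirD_exp_zero _

lemma dirD_dirD_expL_zero (L : E →L[ℝ] 𝔸) (a b : E) : dirD a (dirD b (expL L)) 0 =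
    (1 / 2 : ℝ) • (L a * L b + L b * L a) := by
  have h : expL L = fun x => NormedSpace.exp (L x) := rfl
  rw [h, dirD_comp contDiff_exp_algebra, dirD_comp (contDiff_dirD contDiff_exp_algebra _)]
  simp only [map_zero]
  exact dirD_dirD_exp_zero _ _

lemma dirD_dirD_dirD_expL_zero (L : E →L[ℝ] 𝔸) (a b c : E) :
    dirD a (dirD b (dirD c (expL L))) 0 = (1 / 6 : ℝ) • (L a * L b * L c + L a * L c * L b
      + L b * L a * L c + L b * L c * L a + L c * L a * L b + L c * L b * L a) := by
  have h : expL L = fun x => NormedSpace.exp (L x) := rfl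
  rw [h, dirD_comp contDiff_exp_algebra, dirD_comp (contDiff_dirD contDiff_exp_algebra _),
    dirD_comp (contDiff_dirD (contDiff_dirD contDiff_exp_algebra _) _)]
  simp only [map_zero]
  exact dirD_dirD_dirD_exp_zero _ _ _

/-- Differentiate `exp(L x) exp(-L x) = 1`. This turns the product of two logarithmic derivatives in
the metric into a product of only two differentiated exponentials. -/
lemma dirD_expL_mul_neg (L : E →L[ℝ] 𝔸) (v x : E) :
    dirD v (expL L) x * expL (-L) x = -(expL L x * dirD v (expL (-L)) x) := by
  have h := congrFun (dirD_mul (contDiff_expL L) (contDiff_expL (-L)) v) x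
  have h1 : (fun x => expL L x * expL (-L) x) = fun _ : E => (1 : 𝔸) := funext (expL_mul_neg L)
  rw [h1] at h
  have h2 : dirD v (fun _ : E => (1 : 𝔸)) x = 0 := by simp [dirD]
  rw [h2] at h
  exact eq_neg_of_add_eq_zero_left h.symm

/-- The trace form of the derivatives of `exp (L x)` and `exp (- L x)`. -/
def gramExp (τ : 𝔸 →L[ℝ] ℝ) (L : E →L[ℝ] 𝔸) (c d x : E) : ℝ :=
  τ (dirD c (expL L) x * dirD d (expL (-L)) x)

variable (τ : 𝔸 →L[ℝ] ℝ) (L : E →L[ℝ] 𝔸)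

lemma contDiff_gramExp (c d : E) : ContDiff ℝ ∞ (gramExp τ L c d) :=
  τ.contDiff.comp ((contDiff_dirD (contDiff_expL L) c).mul (contDiff_dirD (contDiff_expL (-L)) d))

lemma gramExp_zero (c d : E) : gramExp τ L c d 0 = -τ (L c * L d) := by
  simp [gramExp, dirD_expL_zero]

lemma dirD_gramExp (b c d : E) : dirD b (gramExp τ L c d) = fun x =>
    τ (dirD b (dirD c (expL L)) x * dirD d (expL (-L)) x
      + dirD c (expL L) x * dirD b (dirD d (expL (-L))) x) := by
  have h1 := contDiff_dirD (contDiff_expL L) c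
  have h2 := contDiff_dirD (contDiff_expL (-L)) d
  have h : gramExp τ L c d = fun x => τ (dirD c (expL L) x * dirD d (expL (-L)) x) := rfl
  rw [h, dirD_clm τ (h1.mul h2), dirD_mul h1 h2]

variable {τ}

/-- With `B, C, D` for `L b, L c, L d`, the derivative is half of `-τ((BC + CB)D) + τ(C(BD + DB))`,
and everything cancels by cyclicity. This makes the exponential chart normal to first order at its
centre. -/
lemma dirD_gramExp_zero (hτ : ∀ x y, τ (x * y) = τ (y * x)) (b c d : E) : dirD b (gramExp τ L c d) 0 = 0 := by
  rw [dirD_gramExp]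
  simp only [dirD_dirD_expL_zero, dirD_expL_zero, neg_apply]
  have h1 : τ (L b * L c * L d) = τ (L c * L d * L b) := by rw [mul_assoc, hτ]
  simp only [smul_mul_assoc, mul_smul_comm, map_add, map_smul, add_mul, mul_add, mul_neg, neg_mul,
    neg_neg, map_neg, ← mul_assoc, h1, smul_eq_mul]
  ring

/-- The second derivatives of `gramExp` at the origin. -/
lemma dirD_dirD_gramExp_zero (hτ : ∀ x y, τ (x * y) = τ (y * x)) (a b c d : E) :
    dirD a (dirD b (gramExp τ L c d)) 0 =
    (1 / 12) * (τ ((L a * L c - L c * L a) * (L b * L d - L d * L b))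
      + τ ((L b * L c - L c * L b) * (L a * L d - L d * L a))) := by
  have k1 := contDiff_dirD (contDiff_expL L) c
  have k2 := contDiff_dirD (contDiff_expL (-L)) d
  have k3 := contDiff_dirD k1 b
  have k4 := contDiff_dirD k2 b
  rw [dirD_gramExp, dirD_clm τ ((k3.mul k2).add (k1.mul k4))]
  have hadd : dirD a (fun x => dirD b (dirD c (expL L)) x * dirD d (expL (-L)) x
      + dirD c (expL L) x * dirD b (dirD d (expL (-L))) x) 0 =
      dirD a (fun x => dirD b (dirD c (expL L)) x * dirD d (expL (-L)) x) 0
      + dirD a (fun x => dirD c (expL L) x * dirD b (dirD d (expL (-L))) x) 0 := by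
    rw [dirD, fderiv_fun_add ((k3.mul k2).differentiable (by simp) 0)
      ((k1.mul k4).differentiable (by simp) 0)]
    rfl
  simp only [hadd]
  rw [dirD_mul k3 k2, dirD_mul k1 k4]
  simp only [dirD_dirD_dirD_expL_zero, dirD_dirD_expL_zero, dirD_expL_zero,
    neg_apply]
  generalize L a = A, L b = B, L c = C, L d = D
  have h4 : ∀ x y z, τ (x * (y * (z * A))) = τ (A * (x * (y * z))) := fun x y z => by
    simpa only [mul_assoc] using hτ (x * (y * z)) A
  have h3 : ∀ x y z, τ (x * (y * (A * z))) = τ (A * (z * (x * y))) := fun x y z => by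
    simpa only [mul_assoc] using hτ (x * y) (A * z)
  have h2 : ∀ x y z, τ (x * (A * (y * z))) = τ (A * (y * (z * x))) := fun x y z => by
    simpa only [mul_assoc] using hτ x (A * (y * z))
  simp only [smul_mul_assoc, mul_smul_comm, map_add, map_sub, map_smul, add_mul, mul_add, sub_mul,
    mul_sub, mul_neg, neg_mul, smul_neg, smul_add,
    neg_neg, map_neg, mul_assoc, h4, h3, h2, smul_eq_mul]
  ring

end Exp

/-! ### The Gram matrix in the exponential chart -/

section Gram

attribute [local instance] Matrix.linftyOpNormedRing Matrix.linftyOpNormedAlgebra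

/-- The doubled inclusion of the symmetric matrices. -/
def symL2 : E 5 →L[ℝ] Mat := (2 : ℝ) • symL

/-- The matrix exponential of `symL2`. -/
def expPos (x : E 5) : Mat := expL symL2 x

/-- The matrix exponential of `-symL2`. -/
def expNeg (x : E 5) : Mat := expL (-symL2) x

/-- The derivative of `expPos` in the direction `v`. -/
def dExpPos (v x : E 5) : Mat := dirD v (expL symL2) x

/-- The derivative of `expNeg` in the direction `v`. -/
def dExpNeg (v x : E 5) : Mat := dirD v (expL (-symL2)) x

lemma expNeg_mul_expPos (x : E 5) : expNeg x * expPos x = 1 := expL_neg_mul symL2 x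

lemma dExpPos_mul_expNeg (v x : E 5) : dExpPos v x * expNeg x = -(expPos x * dExpNeg v x) :=
  dirD_expL_mul_neg symL2 v x

lemma gramExp_symL2 (v w x : E 5) :
    gramExp reTrace symL2 v w x = (dExpPos v x * dExpNeg w x).trace.re := rfl

lemma gramExp_symL2_zero (v w : E 5) :
    gramExp reTrace symL2 v w 0 = -(symL2 v * symL2 w).trace.re := gramExp_zero reTrace symL2 v w

lemma cartanExp_eq (u : SU3) (x : E 5) :
    cartanExp u x = (u : Mat) * expPos x * (u : Mat)ᵀ := rfl

lemma fderiv_cartanExp (u : SU3) (x v : E 5) : fderiv ℝ (cartanExp u) x v =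
    (u : Mat) * dExpPos v x * (u : Mat)ᵀ := by
  have h1 : HasFDerivAt (expL symL2) (fderiv ℝ (expL symL2) x) x :=
    (((contDiff_expL symL2).differentiable (by simp)) x).hasFDerivAt
  have h := (h1.const_mul (u : Mat)).mul_const' (u : Mat)ᵀ
  have e : fderiv ℝ (cartanExp u) x = _ := h.fderiv
  rw [e]
  rfl

lemma expPos_conjTranspose (x : E 5) : (expPos x)ᴴ = expNeg x := by
  have h : (symL2 x)ᴴ = (-symL2) x := by
    have : (sym x : Mat)ᴴ = -(sym x : Mat) := (sym x).2.1
    change ((2 : ℝ) • (sym x : Mat))ᴴ = -((2 : ℝ) • (sym x : Mat))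
    rw [Matrix.conjTranspose_smul, this]
    simp
  change (NormedSpace.exp (symL2 x))ᴴ = NormedSpace.exp ((-symL2) x)
  rw [← h]
  exact (Matrix.exp_conjTranspose _).symm

lemma dCartan_coordField (p : WuManifold) {x : E 5} (hx : x ∈ (chartAt (E 5) p).target) (i : Fin 5) :
    dCartan ((chartAt (E 5) p).symm x) (Riem.coordField p x i) =
      (p.out : Mat) * dExpPos (EuclideanSpace.single i (1 : ℝ)) x * (p.out : Mat)ᵀ := by
  have h1 : MDifferentiableAt (𝓡 5) (𝓡 5) (chartAt (E 5) p).symm x :=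
    mdifferentiableAt_atlas_symm (chart_mem_atlas (E 5) p) hx
  have h2 := mfderiv_comp x
    ((contMDiff_cartanV ((chartAt (E 5) p).symm x)).mdifferentiableAt (by simp)) h1
  have h3 : cartanV ∘ (chartAt (E 5) p).symm = fun x => toV (cartanExp p.out x) :=
    funext fun x => congrArg toV (cartan_chartAt_symm p x)
  rw [h3, mfderiv_eq_fderiv] at h2
  have h4 : fderiv ℝ (fun x => toV (cartanExp p.out x)) x =
      toV.comp (fderiv ℝ (cartanExp p.out) x) :=
    (toV.hasFDerivAt.comp x
      (((contDiff_cartanExp p.out).differentiable (by simp)) x).hasFDerivAt).fderiv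
  rw [← fderiv_cartanExp]
  have h5 := congrArg (fun D : E 5 →L[ℝ] V => ofV (D (EuclideanSpace.single i (1 : ℝ))))
    (h4.symm.trans h2)
  exact h5.symm

lemma reTrace_mul_comm (X Y : Mat) : reTrace (X * Y) = reTrace (Y * X) := by
  rw [reTrace_apply, reTrace_apply, Matrix.trace_mul_comm]

/-- The representative of `p` disappears under the trace, so the Gram matrix is the same function in
all the preferred charts: this is homogeneity in coordinates. -/
lemma gram_symmetricMetric {c : ℝ} (hc : 0 < c) (p : WuManifold) {x : E 5}
    (hx : x ∈ (chartAt (E 5) p).target) (i j : Fin 5) :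
    Riem.gram (symmetricMetric c hc) p x i j = c / 8 * gramExp reTrace symL2
      (EuclideanSpace.single i (1 : ℝ)) (EuclideanSpace.single j (1 : ℝ)) x := by
  have h0 : Riem.gram (symmetricMetric c hc) p x i j = metricForm c ((chartAt (E 5) p).symm x)
    (Riem.coordField p x i) (Riem.coordField p x j) := rfl
  have key : ∀ i : Fin 5, dCartan ((chartAt (E 5) p).symm x) (Riem.coordField p x i) *
      (cartan ((chartAt (E 5) p).symm x))ᴴ =
      (p.out : Mat) * (dExpPos (EuclideanSpace.single i (1 : ℝ)) x * expNeg x)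
        * (p.out : Mat)ᴴ := by
    intro i
    rw [dCartan_coordField p hx, cartan_chartAt_symm, cartanExp_eq, Matrix.conjTranspose_mul,
      Matrix.conjTranspose_mul, expPos_conjTranspose]
    simp only [Matrix.mul_assoc]
    rw [← Matrix.mul_assoc (p.out : Mat)ᵀ, SU3.transpose_mul_conj, Matrix.one_mul]
  have h1 : metricForm c ((chartAt (E 5) p).symm x) (Riem.coordField p x i)
      (Riem.coordField p x j) = -(c / 8) * (dCartan ((chartAt (E 5) p).symm x) (Riem.coordField p x i)
      * (cartan ((chartAt (E 5) p).symm x))ᴴ * (dCartan ((chartAt (E 5) p).symm x)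
      (Riem.coordField p x j) * (cartan ((chartAt (E 5) p).symm x))ᴴ)).trace.re := rfl
  have h2 : dExpPos (EuclideanSpace.single i (1 : ℝ)) x * expNeg x *
      (dExpPos (EuclideanSpace.single j (1 : ℝ)) x * expNeg x) =
      -(dExpPos (EuclideanSpace.single i (1 : ℝ)) x * dExpNeg (EuclideanSpace.single j (1 : ℝ)) x) := by
    rw [dExpPos_mul_expNeg (EuclideanSpace.single j (1 : ℝ)), mul_neg, mul_assoc,
      ← mul_assoc (expNeg x), expNeg_mul_expPos, one_mul]
  rw [h0, h1, key i, key j, trace_conj, h2, gramExp_symL2, Matrix.trace_neg, Complex.neg_re]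
  ring

/-- The Gram matrix of the symmetric space metric in the exponential chart. -/
def gramMat (c : ℝ) (x : E 5) : Matrix (Fin 5) (Fin 5) ℝ :=
  Matrix.of fun i j => c / 8 * gramExp reTrace symL2
      (EuclideanSpace.single i (1 : ℝ)) (EuclideanSpace.single j (1 : ℝ)) x

lemma gramMat_apply (c : ℝ) (x : E 5) (i j : Fin 5) : gramMat c x i j = c / 8 * gramExp reTrace symL2
      (EuclideanSpace.single i (1 : ℝ)) (EuclideanSpace.single j (1 : ℝ)) x := rfl

lemma gram_eventuallyEq {c : ℝ} (hc : 0 < c) (p : WuManifold) :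
    Riem.gram (symmetricMetric c hc) p =ᶠ[𝓝 (chartAt (E 5) p p)] gramMat c := by
  filter_upwards [(chartAt (E 5) p).open_target.mem_nhds (mem_chart_target (E 5) p)] with x hx
  ext i j
  exact gram_symmetricMetric hc p hx i j

lemma contDiff_gramMat (c : ℝ) (i j : Fin 5) : ContDiff ℝ ∞ fun x => gramMat c x i j :=
  contDiff_const.mul (contDiff_gramExp reTrace symL2 _ _)

lemma dirD_const_mul (c : ℝ) {f : E 5 → ℝ} (hf : ContDiff ℝ ∞ f) (v : E 5) :
    dirD v (fun x => c * f x) = fun x => c * dirD v f x := by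
  funext x
  have h := ((hf.differentiable (by simp)) x).hasFDerivAt.const_mul c
  rw [dirD, h.fderiv]
  rfl

lemma pd_gramMat (c : ℝ) (a i j : Fin 5) : Riem.pd a (fun x => gramMat c x i j) =
    fun x => c / 8 * dirD (EuclideanSpace.single a (1 : ℝ)) (gramExp reTrace symL2
      (EuclideanSpace.single i (1 : ℝ)) (EuclideanSpace.single j (1 : ℝ))) x :=
  dirD_const_mul _ (contDiff_gramExp reTrace symL2 _ _) _

lemma pd_gramMat_zero (c : ℝ) (a i j : Fin 5) : Riem.pd a (fun x => gramMat c x i j) 0 = 0 := by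
  rw [pd_gramMat]
  have := dirD_gramExp_zero symL2 reTrace_mul_comm (EuclideanSpace.single a (1 : ℝ))
    (EuclideanSpace.single i (1 : ℝ)) (EuclideanSpace.single j (1 : ℝ))
  exact mul_eq_zero_of_right _ this

/-- The second derivatives of the metric at the centre of the exponential chart. -/
def hessForm (c : ℝ) (a b v w : E 5) : ℝ :=
  c / 8 * ((1 / 12) *
    (((symL2 a * symL2 v - symL2 v * symL2 a) * (symL2 b * symL2 w - symL2 w * symL2 b)).trace.re
    + ((symL2 b * symL2 v - symL2 v * symL2 b) * (symL2 a * symL2 w - symL2 w * symL2 a)).trace.re))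

lemma hessForm_swap (c : ℝ) (a b v w : E 5) : hessForm c a b v w = hessForm c b a v w := by
  rw [hessForm, hessForm, add_comm]

lemma pd_pd_gramMat_zero (c : ℝ) (a b i j : Fin 5) :
    Riem.pd a (Riem.pd b (fun x => gramMat c x i j)) 0 =
      hessForm c (EuclideanSpace.single a (1 : ℝ)) (EuclideanSpace.single b (1 : ℝ))
        (EuclideanSpace.single i (1 : ℝ)) (EuclideanSpace.single j (1 : ℝ)) := by
  rw [pd_gramMat]
  have h := congrFun (dirD_const_mul (c / 8) (contDiff_dirD (contDiff_gramExp reTrace symL2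
    (EuclideanSpace.single i (1 : ℝ)) (EuclideanSpace.single j (1 : ℝ)))
    (EuclideanSpace.single b (1 : ℝ))) (EuclideanSpace.single a (1 : ℝ))) 0
  refine h.trans ?_
  exact congrArg (c / 8 * ·) (dirD_dirD_gramExp_zero symL2 reTrace_mul_comm _ _ _ _)

lemma curvature_hessForm (c : ℝ) (i j k m : E 5) :
    (1 / 2) * (hessForm c i k j m - hessForm c i m j k - hessForm c j k i m + hessForm c j m i k) =
      c / 8 / 4 * ((symL2 i * symL2 j - symL2 j * symL2 i)
        * (symL2 k * symL2 m - symL2 m * symL2 k)).trace.re :=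
  curvature_gramExp (L := symL2) reTrace_mul_comm i j k m (H := hessForm c) (c / 8) fun _ _ _ _ => rfl

end Gram

/-! ### The curvature tensor in terms of commutators -/

lemma sum_single_smul (x : E 5) : ∑ i, x i • EuclideanSpace.single i (1 : ℝ) = x := by
  ext j
  fin_cases j <;> simp [Fin.sum_univ_five]

lemma symL2_apply (x : E 5) : symL2 x = (2 : ℝ) • (sym x : Mat) := rfl

lemma symL2_eq_sum (x : E 5) :
    symL2 x = ∑ i, x i • symL2 (EuclideanSpace.single i (1 : ℝ)) := by
  conv_lhs => rw [← sum_single_smul x]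
  simp only [map_sum, map_smul]

lemma commutator_eq_sum (x y : E 5) : symL2 x * symL2 y - symL2 y * symL2 x =
    ∑ i, ∑ j, (x i * y j) • (symL2 (EuclideanSpace.single i (1 : ℝ)) *
      symL2 (EuclideanSpace.single j (1 : ℝ)) - symL2 (EuclideanSpace.single j (1 : ℝ)) *
      symL2 (EuclideanSpace.single i (1 : ℝ))) := by
  rw [symL2_eq_sum x, symL2_eq_sum y]
  generalize (fun i => symL2 (EuclideanSpace.single i (1 : ℝ))) = A
  simp only [Finset.sum_mul, Finset.mul_sum, smul_sub, Finset.sum_sub_distrib, smul_mul_smul_comm]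
  congr 1
  · rw [Finset.sum_comm]
  · simp only [mul_comm]

lemma trace_commutator_eq_sum (κ : ℝ) (X Y Z W : E 5) :
    κ * ((symL2 X * symL2 Y - symL2 Y * symL2 X) * (symL2 Z * symL2 W - symL2 W * symL2 Z)).trace.re
    = ∑ i, ∑ j, ∑ k, ∑ m, κ * ((symL2 (EuclideanSpace.single i (1 : ℝ)) *
      symL2 (EuclideanSpace.single j (1 : ℝ)) - symL2 (EuclideanSpace.single j (1 : ℝ)) *
      symL2 (EuclideanSpace.single i (1 : ℝ))) * (symL2 (EuclideanSpace.single k (1 : ℝ)) *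
      symL2 (EuclideanSpace.single m (1 : ℝ)) - symL2 (EuclideanSpace.single m (1 : ℝ)) *
      symL2 (EuclideanSpace.single k (1 : ℝ)))).trace.re * X i * Y j * Z k * W m := by
  rw [commutator_eq_sum X, commutator_eq_sum Z, ← reTrace_apply]
  simp only [Finset.sum_mul]
  simp only [Finset.mul_sum, map_sum, smul_mul_smul_comm, map_smul, ← reTrace_apply, smul_eq_mul]
  refine Finset.sum_congr rfl fun i _ => Finset.sum_congr rfl fun j _ =>
    Finset.sum_congr rfl fun k _ => Finset.sum_congr rfl fun m _ => ?_
  ring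

lemma gramMat_zero (c : ℝ) (p : WuManifold) (i j : Fin 5) : gramMat c 0 i j =
    metricForm c p (EuclideanSpace.single i (1 : ℝ)) (EuclideanSpace.single j (1 : ℝ)) := by
  rw [gramMat_apply, gramExp_symL2_zero, metricForm_sym, symL2_apply, symL2_apply, smul_mul_smul_comm,
    Matrix.trace_smul, Complex.smul_re, smul_eq_mul]
  ring

lemma metricForm_eq_sum (c : ℝ) (p : WuManifold) (v w : E 5) :
    metricForm c p v w = ∑ l, ∑ m, gramMat c 0 m l * v l * w m := by
  conv_lhs => rw [← sum_single_smul v, ← sum_single_smul w]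
  simp only [map_sum, map_smul, sum_apply, smul_apply,
    smul_eq_mul, Finset.mul_sum, gramMat_zero c p]
  rw [Finset.sum_comm]
  refine Finset.sum_congr rfl fun i _ => Finset.sum_congr rfl fun j _ => ?_
  rw [metricForm_symm]
  ring

/-- A kernel vector of the Gram matrix would be a nonzero tangent vector of length zero. -/
lemma isUnit_det_gramMat {c : ℝ} (hc : 0 < c) (p : WuManifold) : IsUnit (gramMat c 0).det := by
  rw [isUnit_iff_ne_zero]
  intro h
  obtain ⟨v, hv, hv0⟩ := Matrix.exists_mulVec_eq_zero_iff.2 h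
  have h1 : metricForm c p (WithLp.toLp 2 v) (WithLp.toLp 2 v) = 0 := by
    rw [metricForm_eq_sum, Finset.sum_comm]
    refine Finset.sum_eq_zero fun m _ => ?_
    have := congrFun hv0 m
    simp only [Matrix.mulVec, dotProduct, Pi.zero_apply] at this
    rw [← Finset.sum_mul, this, zero_mul]
  refine (metricForm_pos hc p (WithLp.toLp 2 v) fun h0 => hv ?_).ne' h1
  simpa using congrArg WithLp.ofLp h0

lemma inner_curvature_trace {c : ℝ} (hc : 0 < c) (p : WuManifold) (X Y Z W : E 5) :
    (symmetricMetric c hc).inner p (Riem.curvature (symmetricMetric c hc) p X Y Z) W =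
      c / 2 * (((sym X : Mat) * (sym Y : Mat) - (sym Y : Mat) * (sym X : Mat))
        * ((sym Z : Mat) * (sym W : Mat) - (sym W : Mat) * (sym Z : Mat))).trace.re := by
  have h0 : chartAt (EuclideanSpace ℝ (Fin 5)) p p = 0 := chartAt_self p
  have h := Riem.inner_curvature_of_gram (g := symmetricMetric c hc) (p := p) (h := gramMat c)
    (gram_eventuallyEq hc p) (contDiff_gramMat c) (by rw [h0]; exact isUnit_det_gramMat hc p)
    (by rw [h0]; exact pd_gramMat_zero c)
    (H := fun a b i j => hessForm c (EuclideanSpace.single a (1 : ℝ)) (EuclideanSpace.single b (1 : ℝ))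
        (EuclideanSpace.single i (1 : ℝ)) (EuclideanSpace.single j (1 : ℝ)))
    (by rw [h0]; exact pd_pd_gramMat_zero c) (fun a b i j => hessForm_swap _ _ _ _ _)
    (by rw [h0]; exact metricForm_eq_sum c p) X Y Z W
  simp only [curvature_hessForm] at h
  rw [← trace_commutator_eq_sum] at h
  rw [h]
  -- Four doubled factors contribute 16, and `c/8/4 * 16 = c/2`.
  simp only [symL2_apply, smul_mul_smul_comm, ← smul_sub, Matrix.trace_smul, Complex.smul_re,
    smul_eq_mul]
  ring

/-- The real symmetric trace-free matrix with coordinates `x`. -/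
def symR : E 5 →ₗ[ℝ] Matrix (Fin 3) (Fin 3) ℝ where
  toFun x := !![x 0, x 2, x 3; x 2, x 1, x 4; x 3, x 4, -x 0 - x 1]
  map_add' x y := by
    ext i j
    fin_cases i <;> fin_cases j <;> simp <;> ring
  map_smul' c x := by
    ext i j
    fin_cases i <;> fin_cases j <;> simp <;> ring

lemma symR_injective : Function.Injective symR := by
  intro x y h
  ext i
  fin_cases i
  · exact congrFun (congrFun h 0) 0
  · exact congrFun (congrFun h 1) 1
  · exact congrFun (congrFun h 0) 1
  · exact congrFun (congrFun h 0) 2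
  · exact congrFun (congrFun h 1) 2

lemma symR_transpose (x : E 5) : (symR x)ᵀ = symR x := by
  ext i j
  fin_cases i <;> fin_cases j <;> rfl

lemma symR_trace (x : E 5) : (symR x).trace = 0 := by
  simp [symR, Matrix.trace_fin_three]

lemma sym_eq_symR (x : E 5) : (sym x : Mat) = Complex.I • (symR x).map (algebraMap ℝ ℂ) := rfl

lemma trace_map_re (A : Matrix (Fin 3) (Fin 3) ℝ) : (A.map (algebraMap ℝ ℂ)).trace.re = A.trace := by
  simp [Matrix.trace_fin_three]

lemma metricForm_symR (c : ℝ) (p : WuManifold) (x y : E 5) :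
    metricForm c p x y = c / 2 * (symR x * symR y).trace := by
  rw [metricForm_sym, sym_eq_symR, sym_eq_symR, smul_mul_smul_comm, ← Matrix.map_mul,
    Complex.I_mul_I, neg_smul, one_smul, Matrix.trace_neg, Complex.neg_re, trace_map_re]
  ring

/-- The squared norm of the commutator of two symmetric matrices. -/
def commSq (S T : Matrix (Fin 3) (Fin 3) ℝ) : ℝ := -((S * T - T * S) * (S * T - T * S)).trace

/-- The Gram determinant of two matrices. -/
def gramDet (S T : Matrix (Fin 3) (Fin 3) ℝ) : ℝ :=
  (S * S).trace * (T * T).trace - (S * T).trace ^ 2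

/-- Since `[iS, iT] = -[S, T]`, the trace is that of `[S,T][T,S] = -[S,T]²`, the squared norm of the
real skew matrix `[S,T]`. -/
lemma inner_curvature_symR {c : ℝ} (hc : 0 < c) (p : WuManifold) (X Y : E 5) :
    (symmetricMetric c hc).inner p (Riem.curvature (symmetricMetric c hc) p X Y Y) X =
      c / 2 * commSq (symR X) (symR Y) := by
  rw [inner_curvature_trace]
  congr 1
  have h : ∀ x y : E 5, (sym x : Mat) * (sym y : Mat) - (sym y : Mat) * (sym x : Mat) =
      (symR y * symR x - symR x * symR y).map (algebraMap ℝ ℂ) := by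
    intro x y
    rw [sym_eq_symR, sym_eq_symR, smul_mul_smul_comm, smul_mul_smul_comm, Complex.I_mul_I,
      ← Matrix.map_mul, ← Matrix.map_mul, ← smul_sub]
    ext i j
    simp
  rw [h, h, ← Matrix.map_mul, trace_map_re, commSq, ← Matrix.trace_neg]
  congr 1
  noncomm_ring

lemma sec_symR {c : ℝ} (hc : 0 < c) (p : WuManifold) (X Y : E 5) :
    Riem.sec (symmetricMetric c hc) p X Y =
      2 / c * (commSq (symR X) (symR Y) / gramDet (symR X) (symR Y)) := by
  have h : Riem.sec (symmetricMetric c hc) p X Y =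
      (symmetricMetric c hc).inner p (Riem.curvature (symmetricMetric c hc) p X Y Y) X /
      (metricForm c p X X * metricForm c p Y Y - metricForm c p X Y ^ 2) := rfl
  rw [h, inner_curvature_symR, metricForm_symR, metricForm_symR, metricForm_symR, gramDet]
  have hc' := hc.ne'
  generalize commSq (symR X) (symR Y) = a
  have : c / 2 * (symR X * symR X).trace * (c / 2 * (symR Y * symR Y).trace)
    - (c / 2 * (symR X * symR Y).trace) ^ 2 = c ^ 2 / 4 * ((symR X * symR X).trace *
      (symR Y * symR Y).trace - (symR X * symR Y).trace ^ 2) := by ring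
  rw [this]
  generalize (symR X * symR X).trace * (symR Y * symR Y).trace - (symR X * symR Y).trace ^ 2 = d
  rw [mul_div_mul_comm]
  congr 1
  field_simp
  norm_num

end

/-! ### Commuting planes of symmetric matrices and their orthogonal complements -/

section Flat

variable {S T A A' : Matrix (Fin 3) (Fin 3) ℝ}

lemma trace_mul_transpose_self (K : Matrix (Fin 3) (Fin 3) ℝ) :
    (K * Kᵀ).trace = ∑ i, ∑ j, K i j ^ 2 := by
  simp [Matrix.trace, Matrix.mul_apply, sq]

lemma trace_mul_transpose_self_nonneg (K : Matrix (Fin 3) (Fin 3) ℝ) : 0 ≤ (K * Kᵀ).trace := by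
  rw [trace_mul_transpose_self]
  positivity

lemma eq_zero_of_trace_mul_transpose_self {K : Matrix (Fin 3) (Fin 3) ℝ} (h : (K * Kᵀ).trace = 0) :
    K = 0 := by
  rw [← Matrix.conjTranspose_eq_transpose_of_trivial] at h
  exact Matrix.trace_mul_conjTranspose_self_eq_zero_iff.1 h

lemma commSq_eq (hS : Sᵀ = S) (hT : Tᵀ = T) :
    commSq S T = ((S * T - T * S) * (S * T - T * S)ᵀ).trace := by
  rw [commSq, ← Matrix.trace_neg, Matrix.transpose_sub, Matrix.transpose_mul, Matrix.transpose_mul,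
    hS, hT, ← mul_neg, neg_sub]

lemma commSq_nonneg (hS : Sᵀ = S) (hT : Tᵀ = T) : 0 ≤ commSq S T := by
  rw [commSq_eq hS hT]
  exact trace_mul_transpose_self_nonneg _

lemma mul_comm_of_commSq_eq_zero (hS : Sᵀ = S) (hT : Tᵀ = T) (h : commSq S T = 0) :
    S * T = T * S := by
  rw [commSq_eq hS hT] at h
  exact sub_eq_zero.1 (eq_zero_of_trace_mul_transpose_self h)

lemma gramDet_pos (hS : Sᵀ = S) (hT : Tᵀ = T) (hind : ∀ a b : ℝ, a • S + b • T = 0 → a = 0 ∧ b = 0) :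
    0 < gramDet S T := by
  have hpos : ∀ K : Matrix (Fin 3) (Fin 3) ℝ, Kᵀ = K → K ≠ 0 → 0 < (K * K).trace := by
    intro K hK hne
    have h1 := trace_mul_transpose_self_nonneg K
    have h2 : (K * Kᵀ).trace ≠ 0 := fun h => hne (eq_zero_of_trace_mul_transpose_self h)
    rw [hK] at h1 h2
    exact lt_of_le_of_ne h1 h2.symm
  have ha : 0 < (S * S).trace := hpos S hS fun h => by
    have := (hind 1 0 (by simp [h])).1
    norm_num at this
  set a := (S * S).trace
  set b := (S * T).trace with hb
  -- Strict Cauchy–Schwarz: this is `a` times the component of `T` orthogonal to `S`, and its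
  -- squared norm is `a` times the Gram determinant.
  have hne : (-b) • S + a • T ≠ 0 := fun h => ha.ne' (hind _ _ h).2
  have h1 := hpos _ (by rw [Matrix.transpose_add, Matrix.transpose_smul, Matrix.transpose_smul, hS, hT])
    hne
  have h2 : (((-b) • S + a • T) * ((-b) • S + a • T)).trace = a * gramDet S T := by
    have h3 : (T * S).trace = b := by rw [hb, Matrix.trace_mul_comm]
    simp only [add_mul, mul_add, smul_mul_smul_comm, Matrix.trace_add, Matrix.trace_smul, h3,
      smul_eq_mul, gramDet]
    ring
  rw [h2] at h1
  exact (mul_pos_iff_of_pos_left ha).1 h1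

lemma exists_orthogonal_diagonal (hS : Sᵀ = S) : ∃ (O : Matrix (Fin 3) (Fin 3) ℝ) (d : Fin 3 → ℝ),
    O * Oᵀ = 1 ∧ Oᵀ * O = 1 ∧ Oᵀ * S * O = Matrix.diagonal d := by
  have hH : S.IsHermitian := by
    rw [Matrix.IsHermitian, Matrix.conjTranspose_eq_transpose_of_trivial, hS]
  set O : Matrix (Fin 3) (Fin 3) ℝ := hH.eigenvectorUnitary.1 with hO
  have h1 : Oᵀ * O = 1 := by
    have := Matrix.mem_unitaryGroup_iff'.1 hH.eigenvectorUnitary.2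
    rwa [Matrix.star_eq_conjTranspose, Matrix.conjTranspose_eq_transpose_of_trivial] at this
  have h2 : O * Oᵀ = 1 := by
    have := Matrix.mem_unitaryGroup_iff.1 hH.eigenvectorUnitary.2
    rwa [Matrix.star_eq_conjTranspose, Matrix.conjTranspose_eq_transpose_of_trivial] at this
  refine ⟨O, hH.eigenvalues, h2, h1, ?_⟩
  have h3 : S = O * Matrix.diagonal hH.eigenvalues * Oᵀ := by
    have := hH.spectral_theorem
    rw [← Matrix.conjTranspose_eq_transpose_of_trivial]
    exact this
  have h4 : Oᵀ * S * O = (Oᵀ * O) * Matrix.diagonal hH.eigenvalues * (Oᵀ * O) := by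
    conv_lhs => rw [h3]
    simp only [mul_assoc]
  rw [h4, h1, one_mul, mul_one]

lemma conj_mul_conj {O : Matrix (Fin 3) (Fin 3) ℝ} (hO : O * Oᵀ = 1)
    (S T : Matrix (Fin 3) (Fin 3) ℝ) : (Oᵀ * S * O) * (Oᵀ * T * O) = Oᵀ * (S * T) * O := by
  have : (Oᵀ * S * O) * (Oᵀ * T * O) = Oᵀ * S * (O * Oᵀ) * T * O := by simp only [mul_assoc]
  rw [this, hO, mul_one]
  simp only [mul_assoc]

lemma trace_conj_real {O : Matrix (Fin 3) (Fin 3) ℝ} (hO : O * Oᵀ = 1)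
    (S : Matrix (Fin 3) (Fin 3) ℝ) : (Oᵀ * S * O).trace = S.trace := by
  rw [mul_assoc, Matrix.trace_mul_comm, mul_assoc, hO, mul_one]

lemma commSq_conj {O : Matrix (Fin 3) (Fin 3) ℝ} (hO : O * Oᵀ = 1)
    (S T : Matrix (Fin 3) (Fin 3) ℝ) : commSq (Oᵀ * S * O) (Oᵀ * T * O) = commSq S T := by
  rw [commSq, commSq, conj_mul_conj hO, conj_mul_conj hO, ← sub_mul, ← mul_sub, conj_mul_conj hO,
    trace_conj_real hO]

lemma gramDet_conj {O : Matrix (Fin 3) (Fin 3) ℝ} (hO : O * Oᵀ = 1)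
    (S T : Matrix (Fin 3) (Fin 3) ℝ) : gramDet (Oᵀ * S * O) (Oᵀ * T * O) = gramDet S T := by
  simp only [gramDet, conj_mul_conj hO, trace_conj_real hO]

/-- Identify such matrices with the vectors of their three off-diagonal entries. The entries of the
commutator are, up to sign, those of the cross product `w`, so the left side is `2|w|²`, while the
Gram determinant is `4|w|²`. -/
lemma commSq_of_diag_eq_zero (hA : Aᵀ = A) (hA' : A'ᵀ = A') (h : ∀ i, A i i = 0)
    (h' : ∀ i, A' i i = 0) : commSq A A' = 1 / 2 * gramDet A A' := by
  have e : ∀ i j, A i j = A j i := fun i j => congrFun (congrFun hA.symm i) j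
  have e' : ∀ i j, A' i j = A' j i := fun i j => congrFun (congrFun hA'.symm i) j
  simp only [commSq, gramDet, Matrix.trace_fin_three, Matrix.mul_apply, Matrix.sub_apply,
    Fin.sum_univ_three, h, h', e 1 0, e 2 0, e 2 1, e' 1 0, e' 2 0, e' 2 1]
  ring

/-- In a commuting plane of symmetric trace-free matrices there is a matrix with distinct
eigenvalues: a singular one. -/
lemma exists_det_eq_zero (S T : Matrix (Fin 3) (Fin 3) ℝ) :
    ∃ a b : ℝ, (a ≠ 0 ∨ b ≠ 0) ∧ (a • S + b • T).det = 0 := by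
  set f : ℝ → ℝ := fun t => (Real.cos t • S + Real.sin t • T).det with hf
  have hc : Continuous f := by
    refine Continuous.matrix_det ?_
    exact (Real.continuous_cos.smul continuous_const).add (Real.continuous_sin.smul continuous_const)
  -- The determinant is odd in dimension three, so it changes sign along a half circle of the plane
  -- and vanishes somewhere on it.
  have hπ : f Real.pi = -f 0 := by
    simp only [hf, Real.cos_pi, Real.sin_pi, Real.cos_zero, Real.sin_zero, zero_smul, add_zero,
      one_smul]
    rw [neg_smul, one_smul, Matrix.det_neg]
    simp
    norm_num
  obtain ⟨t, -, ht⟩ : ∃ t ∈ Set.uIcc 0 Real.pi, f t = 0 := by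
    apply intermediate_value_uIcc hc.continuousOn
    rw [hπ, Set.mem_uIcc]
    rcases le_total 0 (f 0) with h | h
    · right; constructor <;> linarith
    · left; constructor <;> linarith
  refine ⟨Real.cos t, Real.sin t, ?_, ht⟩
  by_contra! h
  have := Real.cos_sq_add_sin_sq t
  rw [h.1, h.2] at this
  norm_num at this

lemma trace_diagonal_mul (s : Fin 3 → ℝ) (X : Matrix (Fin 3) (Fin 3) ℝ) :
    (Matrix.diagonal s * X).trace = ∑ i, s i * X i i := by
  simp [Matrix.trace, Matrix.diagonal_mul]

/-- The vectors of sum zero form a two-dimensional space, spanned by `s` and `t`; `x` lies in it and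
is orthogonal to it. -/
lemma eq_zero_of_orthogonal_pair {s t x : Fin 3 → ℝ}
    (hind : ∀ a b : ℝ, a • s + b • t = 0 → a = 0 ∧ b = 0) (hs : ∑ i, s i = 0) (ht : ∑ i, t i = 0)
    (hx : ∑ i, x i = 0) (h1 : ∑ i, s i * x i = 0) (h2 : ∑ i, t i * x i = 0) : ∀ i, x i = 0 := by
  rw [Fin.sum_univ_three] at hs ht hx h1 h2
  have hs2 : s 2 = -s 0 - s 1 := by linarith
  have ht2 : t 2 = -t 0 - t 1 := by linarith
  have hx2 : x 2 = -x 0 - x 1 := by linarith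
  have ext3 : ∀ a b : ℝ, a * s 0 + b * t 0 = 0 → a * s 1 + b * t 1 = 0 → a = 0 ∧ b = 0 := by
    intro a b e0 e1
    refine hind a b (funext fun i => ?_)
    simp only [Pi.add_apply, Pi.smul_apply, smul_eq_mul, Pi.zero_apply]
    fin_cases i
    · exact e0
    · exact e1
    · change a * s 2 + b * t 2 = 0
      rw [hs2, ht2]
      linarith
  have hD : s 0 * t 1 - s 1 * t 0 ≠ 0 := by
    intro hD
    have k1 := ext3 (t 0) (-s 0) (by ring) (by linarith)
    have k2 := ext3 (t 1) (-s 1) (by linarith) (by ring)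
    have k3 := ext3 1 0 (by linarith [k1.2]) (by linarith [k2.2])
    exact one_ne_zero k3.1
  rw [hs2, hx2] at h1
  rw [ht2, hx2] at h2
  have e3 : 2 * x 0 + x 1 = 0 := (mul_eq_zero.1 (show
    (s 0 * t 1 - s 1 * t 0) * (2 * x 0 + x 1) = 0 by
      linear_combination t 1 * h1 - s 1 * h2)).resolve_left hD
  have e4 : x 0 + 2 * x 1 = 0 := (mul_eq_zero.1 (show
    (s 0 * t 1 - s 1 * t 0) * (x 0 + 2 * x 1) = 0 by
      linear_combination s 0 * h2 - t 0 * h1)).resolve_left hD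
  intro i
  fin_cases i
  · change x 0 = 0; linarith
  · change x 1 = 0; linarith
  · change x 2 = 0; linarith

/-- In the eigenbasis of a singular element `U` of the plane, `S` and `T` span the trace-free
diagonal matrices, so orthogonality forces `A` and `A'` to have zero diagonal. -/
lemma commSq_eq_of_flat (hS : Sᵀ = S) (hT : Tᵀ = T) (hA : Aᵀ = A) (hA' : A'ᵀ = A')
    (trS : S.trace = 0) (trT : T.trace = 0) (trA : A.trace = 0) (trA' : A'.trace = 0)
    (hind : ∀ a b : ℝ, a • S + b • T = 0 → a = 0 ∧ b = 0) (hcomm : S * T = T * S)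
    (hSA : (S * A).trace = 0) (hTA : (T * A).trace = 0) (hSA' : (S * A').trace = 0)
    (hTA' : (T * A').trace = 0) : commSq A A' = 1 / 2 * gramDet A A' := by
  obtain ⟨a, b, hab, hdet⟩ := exists_det_eq_zero S T
  have hU : (a • S + b • T)ᵀ = a • S + b • T := by
    rw [Matrix.transpose_add, Matrix.transpose_smul, Matrix.transpose_smul, hS, hT]
  have hU0 : a • S + b • T ≠ 0 := fun h => by
    obtain ⟨h1, h2⟩ := hind a b h
    rcases hab with h | h <;> contradiction
  have hUS : (a • S + b • T) * S = S * (a • S + b • T) := by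
    simp only [add_mul, mul_add, smul_mul_assoc, mul_smul_comm, hcomm]
  have hUT : (a • S + b • T) * T = T * (a • S + b • T) := by
    simp only [add_mul, mul_add, smul_mul_assoc, mul_smul_comm, hcomm]
  have trU : (a • S + b • T).trace = 0 := by simp [Matrix.trace_add, Matrix.trace_smul, trS, trT]
  generalize a • S + b • T = U at *
  obtain ⟨O, d, hO, hO', hd⟩ := exists_orthogonal_diagonal hU
  have hd3 : d 0 + d 1 + d 2 = 0 := by
    rw [← trace_conj_real hO, hd, Matrix.trace_diagonal, Fin.sum_univ_three] at trU
    exact trU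
  have hdp : d 0 * d 1 * d 2 = 0 := by
    have h1 : (Oᵀ * U * O).det = 0 := by rw [Matrix.det_mul, Matrix.det_mul, hdet]; ring
    rw [hd, Matrix.det_diagonal, Fin.prod_univ_three] at h1
    exact h1
  have hd0 : ¬ (d 0 = 0 ∧ d 1 = 0) := by
    rintro ⟨h0, h1⟩
    apply hU0
    have h2 : d = 0 := by
      ext i
      fin_cases i
      · exact h0
      · exact h1
      · simp at *; linarith
    have h3 : U = (O * Oᵀ) * U * (O * Oᵀ) := by rw [hO, one_mul, mul_one]
    have h4 : (O * Oᵀ) * U * (O * Oᵀ) = O * (Oᵀ * U * O) * Oᵀ := by simp only [mul_assoc]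
    rw [h3, h4, hd, h2]
    simp
  -- If two eigenvalues equal `d`, trace zero makes the third `-2d`; the determinant `-2d³`
  -- vanishes, so all three are zero and `U = 0`.
  have h01 : d 0 ≠ d 1 := by
    intro h
    apply hd0
    have h2 : d 2 = -2 * d 1 := by linarith
    rw [h2, h] at hdp
    have : d 1 = 0 := by
      by_contra hne
      apply hne
      have : d 1 ^ 3 = 0 := by linarith
      exact pow_eq_zero_iff (by norm_num) |>.1 this
    exact ⟨h.trans this, this⟩
  have h02 : d 0 ≠ d 2 := by
    intro h
    apply hd0
    have h2 : d 1 = -2 * d 0 := by linarith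
    rw [h2, ← h] at hdp
    have h3 : d 0 ^ 3 = 0 := by linarith
    have := (pow_eq_zero_iff (by norm_num)).1 h3
    exact ⟨this, by linarith⟩
  have h12 : d 1 ≠ d 2 := by
    intro h
    apply hd0
    have h2 : d 0 = -2 * d 1 := by linarith
    rw [h2, ← h] at hdp
    have h3 : d 1 ^ 3 = 0 := by linarith
    have := (pow_eq_zero_iff (by norm_num)).1 h3
    exact ⟨by linarith, this⟩
  have hne : ∀ i j, i ≠ j → d i ≠ d j := by
    intro i j hij
    fin_cases i <;> fin_cases j <;> first
      | exact absurd rfl hij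
      | exact h01
      | exact h02
      | exact h12
      | exact h01.symm
      | exact h02.symm
      | exact h12.symm
  -- A matrix commuting with a diagonal matrix with distinct entries is diagonal.
  have hdiag : ∀ X : Matrix (Fin 3) (Fin 3) ℝ, U * X = X * U →
      Oᵀ * X * O = Matrix.diagonal (Oᵀ * X * O).diag := by
    intro X hX
    ext i j
    by_cases hij : i = j
    · subst hij
      rw [Matrix.diagonal_apply_eq]
      rfl
    rw [Matrix.diagonal_apply_ne _ hij]
    have h1 : (Oᵀ * U * O) * (Oᵀ * X * O) = (Oᵀ * X * O) * (Oᵀ * U * O) := by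
      rw [conj_mul_conj hO, conj_mul_conj hO, hX]
    rw [hd] at h1
    have h2 := congrFun (congrFun h1 i) j
    rw [Matrix.diagonal_mul, Matrix.mul_diagonal] at h2
    have h3 : (d i - d j) * (Oᵀ * X * O) i j = 0 := by linarith
    rcases mul_eq_zero.1 h3 with h | h
    · exfalso
      exact hne i j hij (sub_eq_zero.1 h)
    · exact h
  have hinv : ∀ X : Matrix (Fin 3) (Fin 3) ℝ, Oᵀ * X * O = 0 → X = 0 := by
    intro X hX
    have h3 : X = (O * Oᵀ) * X * (O * Oᵀ) := by rw [hO, one_mul, mul_one]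
    have h4 : (O * Oᵀ) * X * (O * Oᵀ) = O * (Oᵀ * X * O) * Oᵀ := by simp only [mul_assoc]
    rw [h3, h4, hX]
    simp
  have dS := hdiag S hUS
  have dT := hdiag T hUT
  have tS := (trace_conj_real hO S).trans trS
  have tT := (trace_conj_real hO T).trans trT
  have hindc : ∀ a b : ℝ, a • (Oᵀ * S * O).diag + b • (Oᵀ * T * O).diag = 0 → a = 0 ∧ b = 0 := by
    intro a b h
    apply hind
    apply hinv
    have h1 : Oᵀ * (a • S + b • T) * O = a • (Oᵀ * S * O) + b • (Oᵀ * T * O) := by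
      simp only [mul_add, add_mul, mul_smul_comm, smul_mul_assoc]
    rw [h1, dS, dT, ← Matrix.diagonal_smul, ← Matrix.diagonal_smul, Matrix.diagonal_add]
    exact (congrArg Matrix.diagonal h).trans Matrix.diagonal_zero
  have hzero : ∀ X : Matrix (Fin 3) (Fin 3) ℝ, Xᵀ = X → X.trace = 0 → (S * X).trace = 0 →
      (T * X).trace = 0 → ∀ i, (Oᵀ * X * O) i i = 0 := by
    intro X hX trX h1 h2
    rw [← trace_conj_real hO, ← conj_mul_conj hO] at h1 h2
    have tX := (trace_conj_real hO X).trans trX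
    rw [dS, trace_diagonal_mul] at h1
    rw [dT, trace_diagonal_mul] at h2
    exact eq_zero_of_orthogonal_pair hindc tS tT tX h1 h2
  have hsymm : ∀ X : Matrix (Fin 3) (Fin 3) ℝ, Xᵀ = X → (Oᵀ * X * O)ᵀ = Oᵀ * X * O := by
    intro X hX
    rw [Matrix.transpose_mul, Matrix.transpose_mul, Matrix.transpose_transpose, hX, mul_assoc]
  rw [← commSq_conj hO, ← gramDet_conj hO]
  exact commSq_of_diag_eq_zero (hsymm A hA) (hsymm A' hA') (hzero A hA trA hSA hTA)
    (hzero A' hA' trA' hSA' hTA')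

end Flat

/-! ### Two-planes and the biorthogonal curvature -/

lemma exists_linearIndependent_orthogonal (f g : E 5 →ₗ[ℝ] ℝ) :
    ∃ v w : E 5, LinearIndependent ℝ ![v, w] ∧ (f v = 0 ∧ g v = 0) ∧ f w = 0 ∧ g w = 0 := by
  set φ : E 5 →ₗ[ℝ] ℝ × ℝ := f.prod g
  have h1 := φ.finrank_range_add_finrank_ker
  have h2 : Module.finrank ℝ φ.range ≤ 2 := by
    refine (Submodule.finrank_le _).trans ?_
    simp
  have h3 : Module.finrank ℝ (E 5) = 5 := by simp
  -- Two functionals on a five-dimensional space leave a common kernel of dimension at least three.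
  have h4 : 1 < Module.finrank ℝ φ.ker := by omega
  have : Nontrivial φ.ker := Module.nontrivial_of_finrank_pos (R := ℝ) (by omega)
  obtain ⟨v, hv⟩ := exists_ne (0 : φ.ker)
  obtain ⟨w, hw⟩ := exists_linearIndependent_pair_of_one_lt_finrank h4 hv
  have h5 : ∀ u : φ.ker, f u = 0 ∧ g u = 0 := fun u => by
    have := LinearMap.mem_ker.1 u.2
    exact Prod.mk.inj this
  refine ⟨v, w, ?_, h5 v, h5 w⟩
  refine LinearIndependent.pair_iff.2 fun a b hab => LinearIndependent.pair_iff.1 hw a b ?_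
  exact Subtype.ext hab

lemma exists_eq_of_mem_span_range_pair {v w Y : E 5} (h : Y ∈ Submodule.span ℝ (Set.range ![v, w])) :
    ∃ r s : ℝ, r • v + s • w = Y := by
  rwa [Matrix.range_cons, Matrix.range_cons, Matrix.range_empty, Set.union_empty,
    Set.singleton_union, Submodule.mem_span_pair] at h

lemma symR_pair {X Y : E 5} (h : ∀ a b : ℝ, a • X + b • Y = 0 → a = 0 ∧ b = 0) (a b : ℝ)
    (hab : a • symR X + b • symR Y = 0) : a = 0 ∧ b = 0 := by
  apply h
  apply symR_injective
  rw [map_add, map_smul, map_smul, hab, map_zero]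

section Planes

variable {p : WuManifold}

lemma basis_pair (σ : Riem.Plane 5 p) (a b : ℝ)
    (h : a • (σ.basis 0 : TangentSpace (𝓡 5) p) + b • (σ.basis 1 : TangentSpace (𝓡 5) p) = 0) :
    a = 0 ∧ b = 0 := by
  have h1 := Fintype.linearIndependent_iff.1 σ.basis.linearIndependent ![a, b] (by
    rw [Fin.sum_univ_two]
    exact Subtype.ext h)
  exact ⟨h1 0, h1 1⟩

lemma exists_eq_basis (σ : Riem.Plane 5 p) {X : TangentSpace (𝓡 5) p} (hX : X ∈ σ.1) :
    ∃ a b : ℝ, X = a • (σ.basis 0 : TangentSpace (𝓡 5) p) + b • (σ.basis 1 : TangentSpace (𝓡 5) p) := by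
  have h := σ.basis.sum_repr ⟨X, hX⟩
  rw [Fin.sum_univ_two] at h
  exact ⟨_, _, (congrArg Subtype.val h).symm⟩

/-- The first matrix of a basis of a plane. -/
noncomputable def mat0 (σ : Riem.Plane 5 p) : Matrix (Fin 3) (Fin 3) ℝ :=
  symR (σ.basis 0 : TangentSpace (𝓡 5) p)

/-- The second matrix of a basis of a plane. -/
noncomputable def mat1 (σ : Riem.Plane 5 p) : Matrix (Fin 3) (Fin 3) ℝ :=
  symR (σ.basis 1 : TangentSpace (𝓡 5) p)

lemma mat_pair (σ : Riem.Plane 5 p) (a b : ℝ) (h : a • mat0 σ + b • mat1 σ = 0) : a = 0 ∧ b = 0 :=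
  symR_pair (basis_pair σ) a b h

lemma secPlane_eq {c : ℝ} (hc : 0 < c) (σ : Riem.Plane 5 p) :
    Riem.secPlane (symmetricMetric c hc) p σ =
      2 / c * (commSq (mat0 σ) (mat1 σ) / gramDet (mat0 σ) (mat1 σ)) :=
  sec_symR hc p _ _

lemma gramDet_mat_pos (σ : Riem.Plane 5 p) : 0 < gramDet (mat0 σ) (mat1 σ) :=
  gramDet_pos (symR_transpose _) (symR_transpose _) (mat_pair σ)

lemma secPlane_nonneg {c : ℝ} (hc : 0 < c) (σ : Riem.Plane 5 p) :
    0 ≤ Riem.secPlane (symmetricMetric c hc) p σ := by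
  rw [secPlane_eq]
  have h1 := gramDet_mat_pos σ
  have h2 : 0 ≤ commSq (mat0 σ) (mat1 σ) := commSq_nonneg (symR_transpose _) (symR_transpose _)
  positivity

lemma exists_orthogonal_plane {c : ℝ} (hc : 0 < c) (σ : Riem.Plane 5 p) :
    ∃ σ' : Riem.Plane 5 p, Riem.Orthogonal (symmetricMetric c hc) p σ σ' := by
  obtain ⟨v, w, hvw, ⟨h1, h2⟩, h3, h4⟩ := exists_linearIndependent_orthogonal
    (metricForm c p (σ.basis 0 : TangentSpace (𝓡 5) p)).toLinearMap
    (metricForm c p (σ.basis 1 : TangentSpace (𝓡 5) p)).toLinearMap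
  have hr : Module.finrank ℝ (Submodule.span ℝ (Set.range ![v, w])) = 2 := by
    rw [finrank_span_eq_card hvw, Fintype.card_fin]
  refine ⟨⟨Submodule.span ℝ (Set.range ![v, w]), hr⟩, fun X hX Y hY => ?_⟩
  obtain ⟨a, b, rfl⟩ := exists_eq_basis σ hX
  obtain ⟨r, s, rfl⟩ := exists_eq_of_mem_span_range_pair hY
  have key : ∀ X0 X1 : E 5, metricForm c p X0 v = 0 → metricForm c p X1 v = 0 →
      metricForm c p X0 w = 0 → metricForm c p X1 w = 0 →
      metricForm c p (a • X0 + b • X1) (r • v + s • w) = 0 := by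
    intro X0 X1 e1 e2 e3 e4
    simp [e1, e2, e3, e4]
  exact key _ _ h1 h2 h3 h4

lemma trace_mul_eq_zero_of_orthogonal {c : ℝ} (hc : 0 < c) {X Y : E 5}
    (h : metricForm c p X Y = 0) : (symR X * symR Y).trace = 0 := by
  rw [metricForm_symR] at h
  exact (mul_eq_zero.1 h).resolve_left (by positivity)

/-- On the complement of a flat plane the curvature quotient is `1/2`, and `2/c * 1/2 = 1/c`. -/
lemma secPlane_of_flat {c : ℝ} (hc : 0 < c) {σ σ' : Riem.Plane 5 p}
    (hσ : commSq (mat0 σ) (mat1 σ) = 0)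
    (h : Riem.Orthogonal (symmetricMetric c hc) p σ σ') :
    Riem.secPlane (symmetricMetric c hc) p σ' = 1 / c := by
  have ho : ∀ i j, metricForm c p (σ.basis i : TangentSpace (𝓡 5) p)
      (σ'.basis j : TangentSpace (𝓡 5) p) = 0 := fun i j => h _ (σ.basis i).2 _ (σ'.basis j).2
  have h1 := commSq_eq_of_flat (symR_transpose _) (symR_transpose _) (symR_transpose _)
    (symR_transpose _) (symR_trace _) (symR_trace _) (symR_trace _) (symR_trace _) (mat_pair σ)
    (mul_comm_of_commSq_eq_zero (symR_transpose _) (symR_transpose _) hσ)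
    (trace_mul_eq_zero_of_orthogonal hc (ho 0 0)) (trace_mul_eq_zero_of_orthogonal hc (ho 1 0))
    (trace_mul_eq_zero_of_orthogonal hc (ho 0 1)) (trace_mul_eq_zero_of_orthogonal hc (ho 1 1))
  have h2 : commSq (mat0 σ') (mat1 σ') = 1 / 2 * gramDet (mat0 σ') (mat1 σ') := h1
  have h3 := (gramDet_mat_pos σ').ne'
  rw [secPlane_eq, h2]
  field_simp

end Planes

lemma hasPositiveBiorthogonalCurvature_symmetricMetric {c : ℝ} (hc : 0 < c) :
    Riem.HasPositiveBiorthogonalCurvature (symmetricMetric c hc) := by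
  intro p σ
  obtain ⟨σ₀, hσ₀⟩ := exists_orthogonal_plane hc σ
  have key : ∃ m : ℝ, 0 < m ∧ ∀ σ' : Riem.Plane 5 p,
      Riem.Orthogonal (symmetricMetric c hc) p σ σ' → m ≤ (1 / 2) *
        (Riem.secPlane (symmetricMetric c hc) p σ + Riem.secPlane (symmetricMetric c hc) p σ') := by
    by_cases h : commSq (mat0 σ) (mat1 σ) = 0
    · refine ⟨1 / 2 * (1 / c), by positivity, fun σ' h' => ?_⟩
      have h1 := secPlane_nonneg hc σ
      rw [secPlane_of_flat hc h h']
      linarith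
    · have h1 : 0 < commSq (mat0 σ) (mat1 σ) :=
        lt_of_le_of_ne (commSq_nonneg (symR_transpose _) (symR_transpose _)) (Ne.symm h)
      have h2 := gramDet_mat_pos σ
      have h3 : 0 < Riem.secPlane (symmetricMetric c hc) p σ := by
        rw [secPlane_eq]
        positivity
      refine ⟨1 / 2 * Riem.secPlane (symmetricMetric c hc) p σ, by positivity, fun σ' _ => ?_⟩
      have h4 := secPlane_nonneg hc σ'
      linarith
  obtain ⟨m, hm, hle⟩ := key
  -- An orthogonal plane has to be exhibited: over an empty set of planes the real infimum would be
  -- 0, not positive.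
  refine lt_of_lt_of_le hm (le_csInf ⟨_, σ₀, hσ₀, rfl⟩ ?_)
  rintro _ ⟨σ', h', rfl⟩
  exact hle σ' h'

end Wu

theorem mainTheorem3 (B : LinearMap.BilinForm ℝ Wu.su3) (hB : Wu.IsBiInvariant B) :
    ∃ g : Riem.Metric 5 Wu.WuManifold, Wu.IsSymmetricSpaceMetric B g ∧
      (∀ g' : Riem.Metric 5 Wu.WuManifold, Wu.IsSymmetricSpaceMetric B g' → g' = g) ∧
      Riem.HasPositiveBiorthogonalCurvature g := by
  obtain ⟨c, hc, hBc⟩ := hB.exists_trace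
  have hg := Wu.isSymmetricSpaceMetric_symmetricMetric hB hc hBc
  exact ⟨Wu.symmetricMetric c hc, hg, fun _ hg' => hg.eq hB hg',
    Wu.hasPositiveBiorthogonalCurvature_symmetricMetric hc⟩
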